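/- Let $\alpha\in\mathbb{R}\setminus\mathbb{Q}$ with continued fraction approximants $p_n/q_n$, and suppose that $\beta(\alpha)=\limsup_{n\to\infty}\frac{\ln q_{n+1}}{q_n}$ satisfies $0\le\beta(\alpha)<\infty$. Let $\lambda\in\mathbb{R}\setminus\{0\}$. For $\theta\in\mathbb{R}$ let $H_{\lambda,\alpha,\theta}$ be the almost Mathieu operator on $\ell^2(\mathbb{Z})$, $$(H_{\lambda,\alpha,\theta}u)_n=u_{n+1}+u_{n-1}+2\lambda\cos\bigl(2\pi(\theta+n\alpha)\bigr)u_n ,$$ and let $\Sigma_{\lambda,\alpha}=\bigcup_{\theta}\sigma(H_{\lambda,\alpha,\theta})$ be its spectrum (for irrational $\alpha$ the set $\sigma(H_{\lambda,\alpha,\theta})$ does not depend on $\theta$). For $E\in\mathbb{R}$ put $$S_{\lambda,E}(x)=\begin{pmatrix}E-2\lambda\cos 2\pi x&-1\\1&0\end{pmatrix}\in \mathrm{SL}(2,\mathbb{R}).$$ Let $\rho(\alpha,S_{\lambda,E})\in\mathbb{R}/\tfrac12\mathbb{Z}$ be the fibered rotation number: the class modulo $\tfrac12\mathbb{Z}$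 of $\limsup_{n\to\infty}\frac1n\bigl(p_2(T^n(\theta,\varphi))-\varphi\bigr)$, where $p_2(\theta,\varphi)=\varphi$ and $T(\theta,\varphi)=(\theta+\alpha,F(\theta,\varphi))$ is a continuous lift to $\mathbb{R}^2$ of the projective action of $(\alpha,S_{\lambda,E})$ on $\mathbb{R}/\mathbb{Z}\times\mathbb{R}/\tfrac12\mathbb{Z}$, $\varphi$ representing the line spanned by $(\cos2\pi\varphi,\sin2\pi\varphi)$, with $F(\theta,\varphi)-\varphi$ being $1$-periodic in $\theta$ and $\tfrac12$-periodic in $\varphi$. This class depends neither on $(\theta,\varphi)$ nor on the lift. Say that $(\alpha,S_{\lambda,E})$ is analytically reducible in $|\Im x|<\eta$ if there are $B:\mathbb{R}/\mathbb{Z}\to \mathrm{PSL}(2,\mathbb{R})$ (that is, $B:\mathbb{R}\to\mathrm{SL}(2,\mathbb{R})$ with $B(x+1)=\pm B(x)$, the sign not depending on $x$), whose entries extend analytically to the strip $|\Im x|<\eta$, and a constant matrix $C\in\mathrm{SL}(2,\mathbb{R})$ such that $B(x+\alpha)^{-1}S_{\lambda,E}(x)B(x)=C$ for all $x\in\mathbb{R}$.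 Theorem. Let $E_0\in\Sigma_{\lambda,\alpha}$ be such that $2\rho(\alpha,S_{\lambda,E_0})\in\alpha\mathbb{Z}+\mathbb{Z}$, and suppose that $(\alpha,S_{\lambda,E_0})$ is analytically reducible in $|\Im x|<\eta$ for some real $\eta>6\beta(\alpha)$. Then $E_0$ is an endpoint of a gap of $\Sigma_{\lambda,\alpha}$, that is, of a connected component (bounded or unbounded) of $\mathbb{R}\setminus\Sigma_{\lambda,\alpha}$. -/

import Mathlib

open Filter

noncomputable section

namespace AlmostMathieu

/-! ### Arithmetic of the frequency -/

/-- `β(α) = limsup_n (ln q_{n+1}) / q_n`, where `q_n` are the denominators of the continued fraction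
approximants of `α` (for irrational `α`); a priori it may be `∞`. -/
def beta (α : ℝ) : EReal :=
  limsup (fun n : ℕ =>
    ((Real.log ((GenContFract.of α).dens (n + 1)) / (GenContFract.of α).dens n : ℝ) : EReal)) atTop

/-! ### The almost Mathieu operator and its spectrum -/

/-- The Hilbert space `ℓ²(ℤ)`. -/
abbrev EllTwo : Type := lp (fun _ : ℤ => ℂ) 2

theorem memlp_shift (m : ℤ) (u : EllTwo) : Memℓp (fun n : ℤ => u (n + m)) 2 := by
  have h2 : (0 : ℝ) < (2 : ENNReal).toReal := by norm_num
  refine memℓp_gen ?_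
  exact ((lp.memℓp u).summable h2).comp_injective (add_left_injective m)

theorem memlp_mul (v : ℤ → ℝ) (C : ℝ) (hv : ∀ n, |v n| ≤ C) (u : EllTwo) :
    Memℓp (fun n : ℤ => (v n : ℂ) * u n) 2 := by
  have h2 : (0 : ℝ) < (2 : ENNReal).toReal := by norm_num
  have hu : Memℓp (fun n : ℤ => (C : ℂ) * u n) 2 := (lp.memℓp u).const_mul (C : ℂ)
  refine memℓp_gen ((hu.summable h2).of_nonneg_of_le (fun n => by positivity) fun n => ?_)
  refine Real.rpow_le_rpow (norm_nonneg _) ?_ h2.le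
  rw [norm_mul, norm_mul, Complex.norm_real, Complex.norm_real]
  exact mul_le_mul_of_nonneg_right ((hv n).trans (le_abs_self C)) (norm_nonneg _)

/-- The translation `(T_m u)_n = u_{n+m}` on `ℓ²(ℤ)`. -/
def shift (m : ℤ) : EllTwo →L[ℂ] EllTwo :=
  LinearMap.mkContinuous
    { toFun := fun u => ⟨fun n => u (n + m), memlp_shift m u⟩
      map_add' := fun _ _ => rfl
      map_smul' := fun _ _ => rfl } 1 (by
    intro u
    have h2 : (0 : ℝ) < (2 : ENNReal).toReal := by norm_num
    rw [one_mul, lp.norm_eq_tsum_rpow h2, lp.norm_eq_tsum_rpow h2]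
    exact le_of_eq (congrArg (fun t : ℝ => t ^ (1 / (2 : ENNReal).toReal))
      ((Equiv.addRight m).tsum_eq fun n => ‖u n‖ ^ (2 : ENNReal).toReal)))

theorem cos_potential_bound (lam α θ : ℝ) (n : ℤ) :
    |2 * lam * Real.cos (2 * Real.pi * (θ + n * α))| ≤ |2 * lam| := by
  rw [abs_mul]
  exact mul_le_of_le_one_right (abs_nonneg _) (Real.abs_cos_le_one _)

/-- The multiplication operator `u_n ↦ 2 λ cos(2π(θ + nα)) u_n` on `ℓ²(ℤ)`. -/
def cosPotential (lam α θ : ℝ) : EllTwo →L[ℂ] EllTwo :=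
  LinearMap.mkContinuous
    { toFun := fun u =>
        ⟨fun n => ((2 * lam * Real.cos (2 * Real.pi * (θ + n * α)) : ℝ) : ℂ) * u n,
          memlp_mul _ _ (cos_potential_bound lam α θ) u⟩
      map_add' := fun u w => by
        ext n
        exact mul_add _ (u n) (w n)
      map_smul' := fun c u => by
        ext n
        exact mul_left_comm _ c (u n) } |2 * lam| (by
    intro u
    have h2 : (2 : ENNReal) ≠ 0 := by norm_num
    have h := lp.norm_const_smul_le (E := fun _ : ℤ => ℂ) h2 ((2 * lam : ℝ) : ℂ) u
    rw [Complex.norm_real, Real.norm_eq_abs] at h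
    refine le_trans (lp.norm_mono h2 fun n => ?_) h
    have e : ‖((((2 * lam : ℝ) : ℂ) • u : EllTwo) : ℤ → ℂ) n‖ = |2 * lam| * ‖u n‖ := by
      rw [lp.coeFn_smul, Pi.smul_apply, norm_smul, Complex.norm_real, Real.norm_eq_abs]
    rw [e]
    change ‖((2 * lam * Real.cos (2 * Real.pi * (θ + n * α)) : ℝ) : ℂ) * u n‖ ≤ _
    rw [norm_mul, Complex.norm_real]
    exact mul_le_mul_of_nonneg_right (cos_potential_bound lam α θ n) (norm_nonneg _))

/-- The almost Mathieu operator `H_{λ,α,θ}` on `ℓ²(ℤ)`, with coupling `lam = λ`, frequency `α` and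
phase `θ`. -/
def hamiltonian (lam α θ : ℝ) : EllTwo →L[ℂ] EllTwo :=
  shift 1 + shift (-1) + cosPotential lam α θ

theorem hamiltonian_apply (lam α θ : ℝ) (u : EllTwo) (n : ℤ) :
    hamiltonian lam α θ u n =
      u (n + 1) + u (n - 1) + ((2 * lam * Real.cos (2 * Real.pi * (θ + n * α)) : ℝ) : ℂ) * u n :=
  rfl

/-- The spectrum `Σ_{λ,α}`, as the union over all phases `θ` of the (real) spectra of `H_{λ,α,θ}`.
For irrational `α` these spectra all coincide, so that the union is the spectrum of each of them. -/
def Sigma (lam α : ℝ) : Set ℝ :=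
  {E : ℝ | ∃ θ : ℝ, (E : ℂ) ∈ spectrum ℂ (hamiltonian lam α θ)}

/-- A gap of a set `S` of real numbers: a connected component of `ℝ ∖ S`, bounded or not. -/
def IsGap (S G : Set ℝ) : Prop :=
  ∃ x ∈ Sᶜ, G = connectedComponentIn Sᶜ x

/-- `E` is an endpoint of some gap of `S`. -/
def IsGapEndpoint (S : Set ℝ) (E : ℝ) : Prop :=
  ∃ G : Set ℝ, IsGap S G ∧ (IsGLB G E ∨ IsLUB G E)

/-! ### Cocycles, rotation number, reducibility -/

/-- The almost Mathieu cocycle `S_{λ,E} : ℝ/ℤ → SL(2,ℝ)`, as a function on `ℝ`. -/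
def cocycle (lam E : ℝ) (x : ℝ) : Matrix.SpecialLinearGroup (Fin 2) ℝ :=
  ⟨!![E - 2 * lam * Real.cos (2 * Real.pi * x), -1; 1, 0], by simp [Matrix.det_fin_two]⟩

/-- `F` is the fibre component of a continuous lift `(θ, φ) ↦ (θ + α, F (θ, φ))` to `ℝ × ℝ` of the
projective action of `A` on `ℝ/ℤ × ℝ/(1/2)ℤ`, the class of `φ` in `ℝ/(1/2)ℤ` standing for the line
spanned by `(cos 2πφ, sin 2πφ)`. Moreover `F (θ, φ) - φ` is well defined on `ℝ/ℤ × ℝ/(1/2)ℤ`. -/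
structure IsProjectiveLift (A : ℝ → Matrix.SpecialLinearGroup (Fin 2) ℝ) (F : ℝ × ℝ → ℝ) :
    Prop where
  continuous : Continuous F
  periodic_base : ∀ θ φ, F (θ + 1, φ) = F (θ, φ)
  periodic_fibre : ∀ θ φ, F (θ, φ + 1 / 2) = F (θ, φ) + 1 / 2
  lifts : ∀ θ φ, ∃ r : ℝ,
    (A θ).1.mulVec ![Real.cos (2 * Real.pi * φ), Real.sin (2 * Real.pi * φ)] =
      r • ![Real.cos (2 * Real.pi * F (θ, φ)), Real.sin (2 * Real.pi * F (θ, φ))]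

/-- `ρ` is (a real representative, modulo `(1/2)ℤ`, of) the rotation number `ρ(α, A)`: for some
continuous lift `T` of the projective action, and whatever the starting point `(θ, φ)`,
`ρ = limsup_n (p₂(Tⁿ(θ, φ)) - φ) / n`. -/
def IsRotationNumber (α : ℝ) (A : ℝ → Matrix.SpecialLinearGroup (Fin 2) ℝ) (ρ : ℝ) : Prop :=
  ∃ F : ℝ × ℝ → ℝ, IsProjectiveLift A F ∧ ∀ θ φ : ℝ,
    limsup (fun n : ℕ =>
      (((fun p : ℝ × ℝ => (p.1 + α, F p))^[n] (θ, φ)).2 - φ) / (n : ℝ)) atTop = ρ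

/-- `(α, A)` is analytically reducible in the strip `|Im x| < η`: there are `B : ℝ/ℤ → PSL(2,ℝ)`,
written as a map `B : ℝ → SL(2,ℝ)` with `B(x+1) = ±B(x)`, whose entries extend analytically to
`|Im x| < η`, and a constant `C`, such that `B(x+α)⁻¹ A(x) B(x) = C` for all `x`. -/
def IsAnalyticallyReducible (α : ℝ) (A : ℝ → Matrix.SpecialLinearGroup (Fin 2) ℝ) (η : ℝ) : Prop :=
  ∃ (B : ℝ → Matrix.SpecialLinearGroup (Fin 2) ℝ) (C : Matrix.SpecialLinearGroup (Fin 2) ℝ),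
    ((∀ x, (B (x + 1)).1 = (B x).1) ∨ (∀ x, (B (x + 1)).1 = -(B x).1)) ∧
    (∀ i j, ∃ f : ℂ → ℂ, DifferentiableOn ℂ f {z : ℂ | |z.im| < η} ∧
      ∀ x : ℝ, f (x : ℂ) = (((B x).1 i j : ℝ) : ℂ)) ∧
    ∀ x, (B (x + α))⁻¹ * A x * B x = C

end AlmostMathieu

end

noncomputable section

namespace AlmostMathieu

/-! ### Lyapunov functions and the resolvent set -/

/-! Write the conjugacy as `A(x) B(x) = B(x+α) C` and sort the constant `C` by its trace. A
continuous `B`, periodic up to sign, suffices throughout.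

If `C` is triangular with eigenvalues off the unit circle, a quadratic form in the coordinates `y =
B(x)⁻¹(a, b)` increases strictly along orbits. Summing the increments bounds `‖u‖` by `‖(E-H)u‖`, so
`E₀` would lie in the resolvent set (`IsConjugacy.notMem_Sigma_of_hyperbolic`).

If `C` is elliptic, its rotation number differs from `ρ` by an element of `(αℤ+ℤ)/2`
(`IsConjugacy.exists_rotationNumber_eq`). Resonance of `ρ` then lets a rotating frame turn `C` into
`±1` (`IsConjugacy.exists_scalar_of_resonant`). Aubry duality forbids a scalar constant: the two
entries of the first row of `B` would have Fourier coefficients solving one three-term recurrence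
and decaying, so their Wronskian vanishes, the columns of `B` are dependent, and `det B = 1` fails
(`IsConjugacy.false_of_scalar`).

What remains is a parabolic `C` with entry `c ≠ 0`. There `y₁y₂` is monotone along orbits, and an
energy shift of the right sign adds a positive multiple of `a²` to its increment. One side of `E₀`
is therefore free of spectrum (`IsConjugacy.exists_notMem_Sigma_of_parabolic`), which makes `E₀` a
gap endpoint. -/

theorem isUnit_of_isSelfAdjoint_of_le {H : Type*} [NormedAddCommGroup H] [InnerProductSpace ℂ H]
    [CompleteSpace H] {T : H →L[ℂ] H} (hT : IsSelfAdjoint T) {c : ℝ} (hc : 0 < c)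
    (h : ∀ x, c * ‖x‖ ^ 2 ≤ ‖T x‖ ^ 2) : IsUnit T := by
  -- `⟨T²x, x⟩ = ‖Tx‖²`, so the lower bound makes `T²` coercive, hence invertible; its factors
  -- commute, so `T` is invertible as well.
  have hsq : IsUnit (T * T) := by
    refine ContinuousLinearMap.isUnit_of_forall_le_norm_inner_map _ (c := ⟨c, hc.le⟩) hc fun x => ?_
    have hadj : ContinuousLinearMap.adjoint T = T := hT
    have e : inner ℂ ((T * T) x) x = inner ℂ (T x) (T x) := by
      change inner ℂ (T (T x)) x = _
      rw [← ContinuousLinearMap.adjoint_inner_right, hadj]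
    rw [e, inner_self_eq_norm_sq_to_K, mul_comm]
    change c * ‖x‖ ^ 2 ≤ _
    simpa using h x
  exact ((Commute.refl T).isUnit_mul_iff.mp hsq).1

theorem adjoint_shift (m : ℤ) : ContinuousLinearMap.adjoint (shift m) = shift (-m) := by
  refine ((ContinuousLinearMap.eq_adjoint_iff _ _).mpr fun u v => ?_).symm
  rw [lp.inner_eq_tsum, lp.inner_eq_tsum, ← (Equiv.addRight m).tsum_eq]
  refine tsum_congr fun n => ?_
  change inner ℂ (u (n + m + -m)) (v (n + m)) = inner ℂ (u n) (v (n + m))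
  rw [add_neg_cancel_right]

theorem adjoint_cosPotential (lam α θ : ℝ) :
    ContinuousLinearMap.adjoint (cosPotential lam α θ) = cosPotential lam α θ := by
  refine ((ContinuousLinearMap.eq_adjoint_iff _ _).mpr fun u v => ?_).symm
  rw [lp.inner_eq_tsum, lp.inner_eq_tsum]
  refine tsum_congr fun n => ?_
  change inner ℂ (((2 * lam * Real.cos (2 * Real.pi * (θ + n * α)) : ℝ) : ℂ) * u n) (v n) =
    inner ℂ (u n) (((2 * lam * Real.cos (2 * Real.pi * (θ + n * α)) : ℝ) : ℂ) * v n)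
  rw [RCLike.inner_apply, RCLike.inner_apply, map_mul, Complex.conj_ofReal]
  ring

theorem isSelfAdjoint_hamiltonian (lam α θ : ℝ) : IsSelfAdjoint (hamiltonian lam α θ) := by
  change ContinuousLinearMap.adjoint _ = _
  rw [hamiltonian, map_add, map_add, adjoint_shift, adjoint_shift, adjoint_cosPotential, neg_neg,
    add_comm (shift (-1))]

theorem summable_norm_sq (u : EllTwo) : Summable fun n : ℤ => ‖u n‖ ^ 2 := by
  have h := (lp.memℓp u).summable (by norm_num : (0 : ℝ) < (2 : ENNReal).toReal)
  simpa using h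

theorem norm_sq_eq_tsum (u : EllTwo) : ‖u‖ ^ 2 = ∑' n : ℤ, ‖u n‖ ^ 2 := by
  have h := lp.norm_rpow_eq_tsum (by norm_num : (0 : ℝ) < (2 : ENNReal).toReal) u
  simpa using h

/-- A bound for square summable sequences along which `Q` increases up to an error `K w²`. -/
theorem tsum_sq_le_of_lyapunov {u w : ℤ → ℝ} (hu : Summable fun n => u n ^ 2)
    (hw : Summable fun n => w n ^ 2) {q : ℤ → ℝ} {κ M K : ℝ}
    (hq : ∀ n, |q n| ≤ M * (u n ^ 2 + u (n - 1) ^ 2))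
    (h : ∀ n, κ * u n ^ 2 ≤ q (n + 1) - q n + K * w n ^ 2) :
    κ * ∑' n, u n ^ 2 ≤ K * ∑' n, w n ^ 2 := by
  have hu1 : Summable fun n : ℤ => u (n - 1) ^ 2 :=
    (Equiv.subRight (1 : ℤ)).summable_iff (f := fun n => u n ^ 2) |>.mpr hu
  have hqs : Summable q :=
    Summable.of_norm_bounded ((hu.add hu1).mul_left M) hq
  have hqs1 : Summable fun n : ℤ => q (n + 1) :=
    (Equiv.addRight (1 : ℤ)).summable_iff (f := q) |>.mpr hqs
  have e : ∑' n : ℤ, q (n + 1) = ∑' n, q n := (Equiv.addRight (1 : ℤ)).tsum_eq q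
  have := (hu.mul_left κ).tsum_le_tsum h ((hqs1.sub hqs).add (hw.mul_left K))
  rwa [(hqs1.sub hqs).tsum_add (hw.mul_left K), hqs1.tsum_sub hqs, e, sub_self, zero_add,
    tsum_mul_left, tsum_mul_left] at this

/-- Here `w` is, up to sign, the defect `(E-H)u`, viewed as an inhomogeneity in the cocycle step.
Evaluated along `(u n, u (n-1))`, the increments of `Q` telescope to zero, leaving `κ‖u‖² ≤
K‖(E-H)u‖²` uniformly in the phase. The coefficients are real, so real and imaginary parts can be
treated separately. -/
theorem notMem_Sigma_of_lyapunov {lam α E : ℝ} (Q : ℝ → ℝ → ℝ → ℝ) {κ M K : ℝ} (hκ : 0 < κ)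
    (hQ : ∀ x a b, |Q x a b| ≤ M * (a ^ 2 + b ^ 2))
    (h : ∀ x a b w, κ * a ^ 2 ≤
      Q (x + α) ((E - 2 * lam * Real.cos (2 * Real.pi * x)) * a - b + w) a - Q x a b + K * w ^ 2) :
    E ∉ Sigma lam α := by
  rintro ⟨θ, hθ⟩
  refine hθ ?_
  set T : EllTwo →L[ℂ] EllTwo := algebraMap ℂ (EllTwo →L[ℂ] EllTwo) (E : ℂ) - hamiltonian lam α θ
    with hT
  have hself : IsSelfAdjoint T := by
    refine IsSelfAdjoint.sub ?_ (isSelfAdjoint_hamiltonian lam α θ)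
    rw [Algebra.algebraMap_eq_smul_one]
    exact IsSelfAdjoint.smul (Complex.conj_ofReal E) (IsSelfAdjoint.one _)
  have hTn : ∀ (u : EllTwo) (n : ℤ), T u n = E * u n - (u (n + 1) + u (n - 1) +
      ((2 * lam * Real.cos (2 * Real.pi * (θ + n * α)) : ℝ) : ℂ) * u n) := by
    intro u n
    rw [← hamiltonian_apply]
    rfl
  have key : ∀ u w : ℤ → ℝ, (Summable fun n => u n ^ 2) → (Summable fun n => w n ^ 2) →
      (∀ n : ℤ, w n = E * u n - (u (n + 1) + u (n - 1) +
        (2 * lam * Real.cos (2 * Real.pi * (θ + n * α))) * u n)) →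
      κ * ∑' n, u n ^ 2 ≤ K * ∑' n, w n ^ 2 := by
    intro u w hu hw hw'
    refine tsum_sq_le_of_lyapunov (q := fun n => Q (θ + n * α) (u n) (u (n - 1))) hu hw
      (fun n => hQ _ _ _) fun n => ?_
    have h1 := h (θ + n * α) (u n) (u (n - 1)) (-w n)
    have e1 : (E - 2 * lam * Real.cos (2 * Real.pi * (θ + n * α))) * u n - u (n - 1) + -w n
        = u (n + 1) := by
      rw [hw']; ring
    rw [e1, neg_sq] at h1
    rw [add_sub_cancel_right]
    push_cast
    rw [show θ + (n + 1) * α = θ + n * α + α by ring]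
    exact h1
  -- `|K| + 1` in place of `K` because the sign of `K` is not prescribed.
  refine isUnit_of_isSelfAdjoint_of_le hself (c := κ / (|K| + 1)) (by positivity) fun u => ?_
  have hK : K ≤ |K| + 1 := (le_abs_self K).trans (by linarith)
  have split : ∀ v : EllTwo, (Summable fun n => (v n).re ^ 2) ∧ (Summable fun n => (v n).im ^ 2) ∧
      ‖v‖ ^ 2 = ∑' n, (v n).re ^ 2 + ∑' n, (v n).im ^ 2 := by
    intro v
    have hs := summable_norm_sq v
    have e : ∀ n, ‖v n‖ ^ 2 = (v n).re ^ 2 + (v n).im ^ 2 := fun n => by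
      rw [Complex.sq_norm, Complex.normSq_apply]; ring
    have h1 : Summable fun n => (v n).re ^ 2 :=
      hs.of_nonneg_of_le (fun n => sq_nonneg _) fun n => by
        rw [e]; nlinarith [sq_nonneg (v n).im]
    have h2 : Summable fun n => (v n).im ^ 2 :=
      hs.of_nonneg_of_le (fun n => sq_nonneg _) fun n => by
        rw [e]; nlinarith [sq_nonneg (v n).re]
    exact ⟨h1, h2, by rw [norm_sq_eq_tsum, ← h1.tsum_add h2]; exact tsum_congr e⟩
  obtain ⟨ur, ui, hu⟩ := split u
  obtain ⟨wr, wi, hw⟩ := split (T u)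
  have k1 := key _ _ ur wr fun n => by
    rw [hTn, Complex.sub_re, Complex.add_re, Complex.add_re, Complex.re_ofReal_mul,
      Complex.re_ofReal_mul]
  have k2 := key _ _ ui wi fun n => by
    rw [hTn, Complex.sub_im, Complex.add_im, Complex.add_im, Complex.im_ofReal_mul,
      Complex.im_ofReal_mul]
  rw [div_mul_eq_mul_div, div_le_iff₀ (by positivity), hu, hw]
  have n1 : 0 ≤ ∑' n, (T u n).re ^ 2 := tsum_nonneg fun n => sq_nonneg _
  have n2 : 0 ≤ ∑' n, (T u n).im ^ 2 := tsum_nonneg fun n => sq_nonneg _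
  nlinarith

/-- A point of `S` is the endpoint of a gap if one of its one-sided neighbourhoods misses `S`. -/
theorem isGapEndpoint_of_right {S : Set ℝ} {E δ : ℝ} (hE : E ∈ S) (hδ : 0 < δ)
    (h : Set.Ioo E (E + δ) ⊆ Sᶜ) : IsGapEndpoint S E := by
  have hx : E + δ / 2 ∈ Set.Ioo E (E + δ) := ⟨by linarith, by linarith⟩
  have hsub : Set.Ioo E (E + δ) ⊆ connectedComponentIn Sᶜ (E + δ / 2) :=
    isPreconnected_Ioo.subset_connectedComponentIn hx h
  refine ⟨_, ⟨_, h hx, rfl⟩, Or.inl ⟨fun y hy => ?_, fun y hy => ?_⟩⟩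
  · by_contra! hlt
    exact connectedComponentIn_subset _ _ (isPreconnected_connectedComponentIn.Icc_subset hy
      (hsub hx) ⟨hlt.le, hx.1.le⟩) hE
  · exact (isGLB_Ioo (by linarith : E < E + δ)).2 fun z hz => hy (hsub hz)

theorem isGapEndpoint_of_left {S : Set ℝ} {E δ : ℝ} (hE : E ∈ S) (hδ : 0 < δ)
    (h : Set.Ioo (E - δ) E ⊆ Sᶜ) : IsGapEndpoint S E := by
  have hx : E - δ / 2 ∈ Set.Ioo (E - δ) E := ⟨by linarith, by linarith⟩
  have hsub : Set.Ioo (E - δ) E ⊆ connectedComponentIn Sᶜ (E - δ / 2) :=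
    isPreconnected_Ioo.subset_connectedComponentIn hx h
  refine ⟨_, ⟨_, h hx, rfl⟩, Or.inr ⟨fun y hy => ?_, fun y hy => ?_⟩⟩
  · by_contra! hlt
    exact connectedComponentIn_subset _ _ (isPreconnected_connectedComponentIn.Icc_subset
      (hsub hx) hy ⟨hx.2.le, hlt.le⟩) hE
  · exact (isLUB_Ioo (by linarith : E - δ < E)).2 fun z hz => hy (hsub hz)

/-! ### Continuous conjugacies to a constant cocycle -/

/-- `B` is a continuous conjugacy, periodic up to sign, of `(α, A)` to the constant `C`. -/
structure IsConjugacy (α : ℝ) (A : ℝ → Matrix.SpecialLinearGroup (Fin 2) ℝ)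
    (B : ℝ → Matrix (Fin 2) (Fin 2) ℝ) (C : Matrix (Fin 2) (Fin 2) ℝ) : Prop where
  continuous : ∀ i j, Continuous fun x => B x i j
  det : ∀ x, B x 0 0 * B x 1 1 - B x 0 1 * B x 1 0 = 1
  sign : (∀ x i j, B (x + 1) i j = B x i j) ∨ (∀ x i j, B (x + 1) i j = -B x i j)
  conj : ∀ x, (A x).1 * B x = B (x + α) * C

theorem IsAnalyticallyReducible.exists_isConjugacy {α η : ℝ}
    {A : ℝ → Matrix.SpecialLinearGroup (Fin 2) ℝ} (hη : 0 < η)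
    (h : IsAnalyticallyReducible α A η) :
    ∃ B C, C.det = 1 ∧ IsConjugacy α A B C := by
  obtain ⟨B, C, hs, ha, hc⟩ := h
  refine ⟨fun x => (B x).1, C.1, C.2, fun i j => ?_, fun x => ?_, ?_, fun x => ?_⟩
  · obtain ⟨f, hf, hfB⟩ := ha i j
    have h1 : Continuous fun x : ℝ => f x :=
      hf.continuousOn.comp_continuous Complex.continuous_ofReal fun x => by simpa using hη
    have h2 := Complex.continuous_re.comp h1
    refine h2.congr fun x => ?_
    simp [hfB]
  · rw [← Matrix.det_fin_two, (B x).2]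
  · exact hs.imp (fun h x i j => by rw [h]) fun h x i j => by rw [h]; rfl
  · have := congrArg (fun M => (B (x + α) * M).1) (hc x)
    simpa [mul_assoc] using this

theorem IsConjugacy.mul_right {α : ℝ} {A : ℝ → Matrix.SpecialLinearGroup (Fin 2) ℝ}
    {B : ℝ → Matrix (Fin 2) (Fin 2) ℝ} {C C' M : Matrix (Fin 2) (Fin 2) ℝ}
    (h : IsConjugacy α A B C) (hM : M.det = 1) (hC : C * M = M * C') :
    IsConjugacy α A (fun x => B x * M) C' where
  continuous i j := by
    simp only [Matrix.mul_apply, Fin.sum_univ_two]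
    have := h.continuous
    fun_prop
  det x := by
    have h1 := h.det x
    rw [Matrix.det_fin_two] at hM
    simp only [Matrix.mul_apply, Fin.sum_univ_two]
    linear_combination (M 0 0 * M 1 1 - M 0 1 * M 1 0) * h1 + hM
  sign := h.sign.imp (fun h x i j => by simp [Matrix.mul_apply, h])
    fun h x i j => by
      simp only [Matrix.mul_apply, Fin.sum_univ_two, h]; ring
  conj x := by
    rw [← mul_assoc, h.conj, mul_assoc, hC, mul_assoc]

/-- The absolute values of the entries are periodic whichever sign `B` carries. The bound `1 ≤ D`
permits division by `D`. -/
theorem IsConjugacy.exists_bound {α : ℝ} {A : ℝ → Matrix.SpecialLinearGroup (Fin 2) ℝ}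
    {B : ℝ → Matrix (Fin 2) (Fin 2) ℝ} {C : Matrix (Fin 2) (Fin 2) ℝ}
    (h : IsConjugacy α A B C) : ∃ D : ℝ, 1 ≤ D ∧ ∀ x i j, |B x i j| ≤ D := by
  have hb : ∀ i j, ∃ D, ∀ x, |B x i j| ≤ D := by
    intro i j
    have hp : Function.Periodic (fun x => |B x i j|) 1 := fun x => by
      rcases h.sign with h | h <;> simp [h]
    obtain ⟨D, hD⟩ := (hp.compact_of_continuous one_ne_zero (h.continuous i j).abs).bddAbove
    exact ⟨D, fun x => hD ⟨x, rfl⟩⟩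
  choose D hD using hb
  refine ⟨1 + ∑ i, ∑ j, |D i j|, ?_, fun x i j => (hD i j x).trans ?_⟩
  · have : 0 ≤ ∑ i, ∑ j, |D i j| := by positivity
    linarith
  · have h1 : |D i j| ≤ ∑ j, |D i j| :=
      Finset.single_le_sum (f := fun j => |D i j|) (fun _ _ => abs_nonneg _) (Finset.mem_univ j)
    have h2 : ∑ j, |D i j| ≤ ∑ i, ∑ j, |D i j| :=
      Finset.single_le_sum (f := fun i => ∑ j, |D i j|)
        (fun _ _ => Finset.sum_nonneg fun _ _ => abs_nonneg _) (Finset.mem_univ i)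
    linarith [le_abs_self (D i j)]

/-! ### Energies with a triangular constant: hyperbolic and parabolic cases. -/

section Triangular

variable {lam α E μ ν c : ℝ} {B : ℝ → Matrix (Fin 2) (Fin 2) ℝ}

/-- First coordinate of `B(x)⁻¹ (a, b)`. -/
def coordOne (B : ℝ → Matrix (Fin 2) (Fin 2) ℝ) (x a b : ℝ) : ℝ := B x 1 1 * a - B x 0 1 * b

/-- Second coordinate of `B(x)⁻¹ (a, b)`. -/
def coordTwo (B : ℝ → Matrix (Fin 2) (Fin 2) ℝ) (x a b : ℝ) : ℝ := B x 0 0 * b - B x 1 0 * a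

theorem IsConjugacy.cocycle_entries {C : Matrix (Fin 2) (Fin 2) ℝ}
    (h : IsConjugacy α (cocycle lam E) B C) (x : ℝ) (j : Fin 2) :
    (E - 2 * lam * Real.cos (2 * Real.pi * x)) * B x 0 j - B x 1 j =
        B (x + α) 0 0 * C 0 j + B (x + α) 0 1 * C 1 j ∧
      B x 0 j = B (x + α) 1 0 * C 0 j + B (x + α) 1 1 * C 1 j := by
  have h0 := congrFun (congrFun (h.conj x) 0) j
  have h1 := congrFun (congrFun (h.conj x) 1) j
  simp only [cocycle, Matrix.mul_apply, Fin.sum_univ_two] at h0 h1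
  simp at h0 h1
  exact ⟨by linarith, h1⟩

theorem IsConjugacy.eq_coords {A : ℝ → Matrix.SpecialLinearGroup (Fin 2) ℝ}
    {C : Matrix (Fin 2) (Fin 2) ℝ} (h : IsConjugacy α A B C) (x a b : ℝ) :
    a = B x 0 0 * coordOne B x a b + B x 0 1 * coordTwo B x a b := by
  rw [coordOne, coordTwo]
  linear_combination (-a) * h.det x

/-- The perturbation is the vector `(w, 0)`, and `B(x+α)⁻¹` sends it to `w` times `(B₁₁, -B₁₀)`. -/
theorem IsConjugacy.coords_step (h : IsConjugacy α (cocycle lam E) B !![μ, c; 0, ν])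
    (x a b w : ℝ) :
    coordOne B (x + α) ((E - 2 * lam * Real.cos (2 * Real.pi * x)) * a - b + w) a =
        μ * coordOne B x a b + c * coordTwo B x a b + w * B (x + α) 1 1 ∧
      coordTwo B (x + α) ((E - 2 * lam * Real.cos (2 * Real.pi * x)) * a - b + w) a =
        ν * coordTwo B x a b - w * B (x + α) 1 0 := by
  obtain ⟨h1, h2⟩ := h.cocycle_entries x 0
  obtain ⟨h3, h4⟩ := h.cocycle_entries x 1
  have hd := h.det (x + α)
  have ha := h.eq_coords x a b
  have hb : b = B x 1 0 * coordOne B x a b + B x 1 1 * coordTwo B x a b := by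
    rw [coordOne, coordTwo]
    linear_combination (-b) * h.det x
  generalize hY1 : coordOne B x a b = y₁ at *
  generalize hY2 : coordTwo B x a b = y₂ at *
  simp at h1 h2 h3 h4
  have e1 : (E - 2 * lam * Real.cos (2 * Real.pi * x)) * a - b =
      B (x + α) 0 0 * (μ * y₁ + c * y₂) + B (x + α) 0 1 * (ν * y₂) := by
    rw [ha, hb]; linear_combination y₁ * h1 + y₂ * h3
  have e2 : a = B (x + α) 1 0 * (μ * y₁ + c * y₂) + B (x + α) 1 1 * (ν * y₂) := by
    rw [ha]; linear_combination y₁ * h2 + y₂ * h4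
  rw [e1, coordOne, coordTwo]
  constructor
  · linear_combination (-B (x + α) 0 1) * e2 + (μ * y₁ + c * y₂) * hd
  · linear_combination (B (x + α) 0 0) * e2 + (ν * y₂) * hd

theorem sq_coords_le {D : ℝ} (hD : ∀ x i j, |B x i j| ≤ D) (x a b : ℝ) :
    coordOne B x a b ^ 2 ≤ 2 * D ^ 2 * (a ^ 2 + b ^ 2) ∧
      coordTwo B x a b ^ 2 ≤ 2 * D ^ 2 * (a ^ 2 + b ^ 2) := by
  have key : ∀ p q : ℝ, |p| ≤ D → |q| ≤ D → ∀ a b : ℝ,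
      (p * a - q * b) ^ 2 ≤ 2 * D ^ 2 * (a ^ 2 + b ^ 2) := by
    intro p q hp hq a b
    have hp2 := sq_le_sq' (abs_le.mp hp).1 (abs_le.mp hp).2
    have hq2 := sq_le_sq' (abs_le.mp hq).1 (abs_le.mp hq).2
    nlinarith [sq_nonneg (p * a + q * b), mul_le_mul_of_nonneg_right hp2 (sq_nonneg a),
      mul_le_mul_of_nonneg_right hq2 (sq_nonneg b)]
  exact ⟨key _ _ (hD x 1 1) (hD x 0 1) a b, by
    rw [add_comm (a ^ 2)]; exact key _ _ (hD x 0 0) (hD x 1 0) b a⟩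

/-- The two sides differ by `|a| (z' ∓ z)²`. The factor `1 - |a|` carries the sign that makes the
form work for contraction and expansion alike. -/
theorem sq_le_sub_of_step (a z z' : ℝ) :
    (1 - |a|) ^ 2 * z ^ 2 ≤ (z' - a * z) ^ 2 - (1 - |a|) * (z' ^ 2 - z ^ 2) := by
  rcases abs_cases a with ⟨h, h0⟩ | ⟨h, h0⟩ <;> rw [h]
  · nlinarith [mul_nonneg h0 (sq_nonneg (z - z'))]
  · nlinarith [mul_nonneg (neg_nonneg.mpr h0.le) (sq_nonneg (z + z'))]

/-- The energy of a cocycle conjugate to a constant hyperbolic matrix is in the resolvent set. -/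
theorem IsConjugacy.notMem_Sigma_of_hyperbolic
    (h : IsConjugacy α (cocycle lam E) B !![μ, c; 0, ν]) (hμ : |μ| ≠ 1) (hν : |ν| ≠ 1) :
    E ∉ Sigma lam α := by
  obtain ⟨D, hD1, hD⟩ := h.exists_bound
  set p := (1 - |μ|) ^ 2 with hp
  set r := (1 - |ν|) ^ 2 with hr
  have hp0 : 0 < p := by
    have : 1 - |μ| ≠ 0 := fun h => hμ (by linarith)
    positivity
  have hr0 : 0 < r := by
    have : 1 - |ν| ≠ 0 := fun h => hν (by linarith)
    positivity
  -- The weight of the second coordinate is large enough to absorb `2c²y₂²`, which the off-diagonal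
  -- entry creates in the first, and still leave `p y₂²`.
  set N := (2 * c ^ 2 + p) / r with hN
  have hNr : N * r = 2 * c ^ 2 + p := div_mul_cancel₀ _ hr0.ne'
  have hN0 : 0 ≤ N := by positivity
  refine notMem_Sigma_of_lyapunov
    (fun x a b => -(1 - |μ|) * coordOne B x a b ^ 2 - N * (1 - |ν|) * coordTwo B x a b ^ 2)
    (κ := p / (2 * D ^ 2)) (M := (abs (1 - |μ|) + N * abs (1 - |ν|)) * (2 * D ^ 2))
    (K := 2 * D ^ 2 + N * D ^ 2) (by positivity) (fun x a b => ?_) fun x a b w => ?_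
  · obtain ⟨h1, h2⟩ := sq_coords_le hD x a b
    refine (abs_sub _ _).trans ?_
    rw [abs_mul, abs_mul, abs_mul, abs_neg, abs_of_nonneg hN0,
      abs_of_nonneg (sq_nonneg (coordOne B x a b)),
      abs_of_nonneg (sq_nonneg (coordTwo B x a b))]
    have h3 := mul_le_mul_of_nonneg_left h1 (abs_nonneg (1 - |μ|))
    have h4 := mul_le_mul_of_nonneg_left h2 (by positivity : 0 ≤ N * abs (1 - |ν|))
    linarith
  · obtain ⟨s1, s2⟩ := h.coords_step x a b w
    have ha := h.eq_coords x a b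
    set z₁ := coordOne B (x + α) ((E - 2 * lam * Real.cos (2 * Real.pi * x)) * a - b + w) a
    set z₂ := coordTwo B (x + α) ((E - 2 * lam * Real.cos (2 * Real.pi * x)) * a - b + w) a
    set y₁ := coordOne B x a b
    set y₂ := coordTwo B x a b
    have t1 := sq_le_sub_of_step μ y₁ z₁
    have t2 := sq_le_sub_of_step ν y₂ z₂
    rw [← hp, show z₁ - μ * y₁ = c * y₂ + w * B (x + α) 1 1 by rw [s1]; ring] at t1
    rw [← hr, show z₂ - ν * y₂ = -(w * B (x + α) 1 0) by rw [s2]; ring] at t2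
    have hbd : ∀ x i j, B x i j ^ 2 ≤ D ^ 2 := fun x i j =>
      sq_le_sq' (abs_le.mp (hD x i j)).1 (abs_le.mp (hD x i j)).2
    have b1 := mul_le_mul_of_nonneg_right (hbd (x + α) 1 1) (sq_nonneg w)
    have b2 := mul_le_mul_of_nonneg_right (hbd (x + α) 1 0) (sq_nonneg w)
    have b3 := mul_le_mul_of_nonneg_right (hbd x 0 0) (sq_nonneg y₁)
    have b4 := mul_le_mul_of_nonneg_right (hbd x 0 1) (sq_nonneg y₂)
    have t1' : p * y₁ ^ 2 ≤ 2 * c ^ 2 * y₂ ^ 2 + 2 * D ^ 2 * w ^ 2 -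
        (1 - |μ|) * (z₁ ^ 2 - y₁ ^ 2) := by
      nlinarith [sq_nonneg (c * y₂ - w * B (x + α) 1 1)]
    have t2' : N * (r * y₂ ^ 2) ≤ N * (D ^ 2 * w ^ 2 - (1 - |ν|) * (z₂ ^ 2 - y₂ ^ 2)) :=
      mul_le_mul_of_nonneg_left (by nlinarith) hN0
    have ha2 : a ^ 2 ≤ 2 * D ^ 2 * (y₁ ^ 2 + y₂ ^ 2) := by
      rw [ha]; nlinarith [sq_nonneg (B x 0 0 * y₁ - B x 0 1 * y₂)]
    have ha3 : p / (2 * D ^ 2) * a ^ 2 ≤ p * (y₁ ^ 2 + y₂ ^ 2) := by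
      refine (mul_le_mul_of_nonneg_left ha2 (by positivity)).trans (le_of_eq ?_)
      have : D ≠ 0 := by positivity
      field_simp
    rw [← mul_assoc, hNr] at t2'
    linarith

/-- Moving the energy in the direction `-τ` off that of a cocycle conjugate to the parabolic matrix
with entry `c`, `0 < τ σ c`, leads into the resolvent set. -/
theorem IsConjugacy.exists_notMem_Sigma_of_parabolic {σ τ : ℝ} (hσ : σ ^ 2 = 1) (hτ : τ ^ 2 = 1)
    (h : IsConjugacy α (cocycle lam E) B !![σ, c; 0, σ]) (hc : 0 < τ * σ * c) :
    ∃ δ : ℝ, 0 < δ ∧ ∀ e : ℝ, 0 < e → e < δ → E - τ * e ∉ Sigma lam α := by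
  obtain ⟨D, hD1, hD⟩ := h.exists_bound
  have hσa : |σ| = 1 := by rwa [← sq_eq_sq₀ (abs_nonneg _) zero_le_one, sq_abs, one_pow]
  have hτa : |τ| = 1 := by rwa [← sq_eq_sq₀ (abs_nonneg _) zero_le_one, sq_abs, one_pow]
  set G := τ * σ * c with hG
  -- `L` bounds all errors of order `v²`: the first term comes from completing the square against `G
  -- y₂²`, the second from the purely quadratic one. The threshold `1 / (8L)` gives `2Le²a² ≤
  -- (e/4)a²`.
  set L := (2 * D + |c| * D) ^ 2 / (4 * G) + D ^ 2 with hL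
  have hL0 : 0 < L := by positivity
  refine ⟨1 / (8 * L), by positivity, fun e he hed => ?_⟩
  have heL : 8 * L * e < 1 := by rwa [lt_div_iff₀ (by positivity), mul_comm] at hed
  refine notMem_Sigma_of_lyapunov (fun x a b => τ * (coordOne B x a b * coordTwo B x a b))
    (κ := e / 2) (M := 2 * D ^ 2) (K := 1 / e + 2 * L) (by positivity)
    (fun x a b => ?_) fun x a b w => ?_
  · obtain ⟨h1, h2⟩ := sq_coords_le hD x a b
    rw [abs_mul, hτa, one_mul, abs_le]
    constructor <;> nlinarith [sq_nonneg (coordOne B x a b + coordTwo B x a b),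
      sq_nonneg (coordOne B x a b - coordTwo B x a b)]
  · obtain ⟨s1, s2⟩ := h.coords_step x a b (w - τ * e * a)
    have ha := h.eq_coords x a b
    have hf : B x 0 0 = B (x + α) 1 0 * σ := by simpa using (h.cocycle_entries x 0).2
    rw [show (E - τ * e - 2 * lam * Real.cos (2 * Real.pi * x)) * a - b + w =
      (E - 2 * lam * Real.cos (2 * Real.pi * x)) * a - b + (w - τ * e * a) by ring, s1, s2]
    set y₁ := coordOne B x a b
    set y₂ := coordTwo B x a b
    set v := w - τ * e * a with hv
    set k := σ * B (x + α) 1 1 + B x 0 1 - σ * c * B x 0 0 with hk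
    have hb10 : B (x + α) 1 0 = σ * B x 0 0 := by rw [hf]; linear_combination (-B (x + α) 1 0) * hσ
    -- The gain `G y₂²` is the parabolic shear; `e a²` comes from the energy shift, since `-τ v (B₀₀
    -- y₁)` contains `-τ v a` and `τ² = 1`. Of `e a²`, a quarter is spent on the cross term with `w`
    -- and a quarter on `v²`, leaving `κ = e / 2`.
    have incr : τ * ((σ * y₁ + c * y₂ + v * B (x + α) 1 1) * (σ * y₂ - v * B (x + α) 1 0)) -
        τ * (y₁ * y₂) = G * y₂ ^ 2 + e * a ^ 2 - τ * w * a + τ * (v * k) * y₂ -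
          τ * σ * B x 0 0 * B (x + α) 1 1 * v ^ 2 := by
      have e0 : B x 0 0 * y₁ = a - B x 0 1 * y₂ := by linarith
      rw [hb10, hG]
      linear_combination (τ * y₁ * y₂ - τ * v * (B x 0 0 * y₁)) * hσ - τ * v * e0 +
        e * a ^ 2 * hτ - τ * a * hv + τ * v * y₂ * hk
    have hkD : k ^ 2 ≤ (2 * D + |c| * D) ^ 2 := by
      rw [← sq_abs]
      gcongr
      have t1 : |k| ≤ |σ * B (x + α) 1 1| + |B x 0 1| + |σ * c * B x 0 0| :=
        (abs_sub _ _).trans (by gcongr; exact abs_add_le _ _)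
      rw [abs_mul, abs_mul, abs_mul, hσa, one_mul, one_mul] at t1
      have t2 := mul_le_mul_of_nonneg_left (hD x 0 0) (abs_nonneg c)
      linarith [hD (x + α) 1 1, hD x 0 1]
    have q1 : -(G * y₂ ^ 2) - (2 * D + |c| * D) ^ 2 / (4 * G) * v ^ 2 ≤ τ * (v * k) * y₂ := by
      have t : k ^ 2 * v ^ 2 / (4 * G) ≤ (2 * D + |c| * D) ^ 2 / (4 * G) * v ^ 2 := by
        rw [div_mul_eq_mul_div]; gcongr
      have t' : G * y₂ ^ 2 + τ * (v * k) * y₂ + k ^ 2 * v ^ 2 / (4 * G) =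
          G * (y₂ + τ * v * k / (2 * G)) ^ 2 := by
        field_simp
        linear_combination (-4 * k ^ 2 * v ^ 2) * hτ
      have t'' : 0 ≤ G * (y₂ + τ * v * k / (2 * G)) ^ 2 := by positivity
      linarith only [t, t', t'']
    have q2 : τ * σ * B x 0 0 * B (x + α) 1 1 * v ^ 2 ≤ D ^ 2 * v ^ 2 := by
      gcongr
      refine (le_abs_self _).trans ?_
      rw [abs_mul, abs_mul, abs_mul, hτa, hσa, one_mul, one_mul, sq]
      exact mul_le_mul (hD _ _ _) (hD _ _ _) (abs_nonneg _) (by linarith)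
    have q3 : τ * w * a ≤ e / 4 * a ^ 2 + 1 / e * w ^ 2 := by
      have : e / 4 * a ^ 2 + 1 / e * w ^ 2 - τ * w * a = e / 4 * (a - 2 * τ * w / e) ^ 2 := by
        field_simp
        linear_combination (-4 * w ^ 2) * hτ
      have t : 0 ≤ e / 4 * (a - 2 * τ * w / e) ^ 2 := by positivity
      linarith only [this, t]
    have q4 : v ^ 2 ≤ 2 * e ^ 2 * a ^ 2 + 2 * w ^ 2 := by
      have : v ^ 2 + (w + τ * e * a) ^ 2 = 2 * e ^ 2 * a ^ 2 + 2 * w ^ 2 := by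
        rw [hv]; linear_combination (2 * e ^ 2 * a ^ 2) * hτ
      exact this ▸ le_add_of_nonneg_right (sq_nonneg _)
    have q5 : L * v ^ 2 ≤ L * (2 * e ^ 2 * a ^ 2 + 2 * w ^ 2) := by gcongr
    have q6 : 8 * L * e * (e * a ^ 2) ≤ 1 * (e * a ^ 2) := by gcongr
    have q7 : L * v ^ 2 = (2 * D + |c| * D) ^ 2 / (4 * G) * v ^ 2 + D ^ 2 * v ^ 2 := by
      rw [hL]; ring
    rw [incr]
    linarith only [q1, q2, q3, q5, q6, q7]

end Triangular

/-! ### Aubry duality excludes reducibility to a scalar -/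

theorem eq_zero_of_three_term {z c : ℤ → ℂ} (hz : ∀ n, z (n + 1) + z (n - 1) = c n * z n)
    (h0 : z 0 = 0) (h1 : z 1 = 0) (n : ℤ) : z n = 0 := by
  have key : ∀ n : ℤ, z n = 0 ∧ z (n + 1) = 0 := by
    intro n
    induction n using Int.induction_on with
    | zero => exact ⟨h0, by simpa using h1⟩
    | succ i ih =>
      have h := hz (i + 1)
      rw [ih.2, add_sub_cancel_right, ih.1] at h
      exact ⟨ih.2, by simpa using h⟩
    | pred i ih =>
      have h := hz (-i)
      rw [ih.2, ih.1] at h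
      exact ⟨by simpa using h, by simpa using ih.1⟩
  exact (key n).1

/-- Two decaying solutions of a three-term recurrence have zero Wronskian. -/
theorem exists_linear_relation_of_three_term {a b c : ℤ → ℂ}
    -- Both sequences obey the same coefficients `c`, which is what makes the Wronskian constant.
    (ha : ∀ n, a (n + 1) + a (n - 1) = c n * a n) (hb : ∀ n, b (n + 1) + b (n - 1) = c n * b n)
    (ha0 : Tendsto a cofinite (nhds 0)) (hb0 : Tendsto b cofinite (nhds 0)) :
    ∃ s t : ℂ, (s ≠ 0 ∨ t ≠ 0) ∧ ∀ n, s * a n + t * b n = 0 := by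
  have hstep : ∀ n : ℤ, a (n + 1) * b (n + 1 + 1) - a (n + 1 + 1) * b (n + 1) =
      a n * b (n + 1) - a (n + 1) * b n := by
    intro n
    have h1 := ha (n + 1)
    have h2 := hb (n + 1)
    rw [add_sub_cancel_right] at h1 h2
    linear_combination a (n + 1) * h2 - b (n + 1) * h1
  have hconst : ∀ n : ℕ, a n * b (n + 1) - a (n + 1) * b n = a 0 * b 1 - a 1 * b 0 := by
    intro n
    induction n with
    | zero => simp
    | succ n ih => rw [← ih, ← hstep n]; push_cast; rfl
  have hW : a 0 * b 1 - a 1 * b 0 = 0 := by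
    have i0 : Tendsto (fun n : ℕ => (n : ℤ)) atTop cofinite := by
      rw [← Nat.cofinite_eq_atTop]; exact Nat.cast_injective.tendsto_cofinite
    have i1 : Tendsto (fun n : ℕ => (n : ℤ) + 1) atTop cofinite := by
      rw [← Nat.cofinite_eq_atTop]
      exact ((add_left_injective (1 : ℤ)).comp Nat.cast_injective).tendsto_cofinite
    have h := (((ha0.comp i0).mul (hb0.comp i1)).sub ((ha0.comp i1).mul (hb0.comp i0)))
    refine tendsto_nhds_unique (f := fun _ : ℕ => a 0 * b 1 - a 1 * b 0) (l := atTop)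
      tendsto_const_nhds ?_
    simpa using h.congr fun n => hconst n
  have ext : ∀ s t : ℂ, s * a 0 + t * b 0 = 0 → s * a 1 + t * b 1 = 0 →
      ∀ n, s * a n + t * b n = 0 := fun s t h0 h1 =>
    eq_zero_of_three_term (z := fun n => s * a n + t * b n) (c := c)
      (fun n => by linear_combination s * ha n + t * hb n) h0 h1
  -- The pair `(b, -a)` at index `0` annihilates both initial values because the Wronskian is zero;
  -- if it is trivial, index `1` supplies the pair.
  by_cases h0 : a 0 = 0 ∧ b 0 = 0
  · by_cases h1 : a 1 = 0 ∧ b 1 = 0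
    · exact ⟨1, 0, Or.inl one_ne_zero, ext _ _ (by simp [h0.1]) (by simp [h1.1])⟩
    · refine ⟨b 1, -a 1, ?_, ext _ _ (by simp [h0.1, h0.2]) (by ring)⟩
      rw [neg_ne_zero]; tauto
  · refine ⟨b 0, -a 0, ?_, ext _ _ (by ring) (by linear_combination -hW)⟩
    rw [neg_ne_zero]; tauto

/-! ### Fourier coefficients on the circle and the dual recurrence. -/

section Fourier

variable {T : ℝ} [hT : Fact (0 < T)]

theorem fourierCoeff_fourier_mul (F : AddCircle T → ℂ) (m n : ℤ) :
    fourierCoeff (fun t => fourier m t * F t) n = fourierCoeff F (n - m) := by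
  unfold fourierCoeff
  refine MeasureTheory.integral_congr_ae (MeasureTheory.ae_of_all _ fun t => ?_)
  simp only [smul_eq_mul]
  rw [← mul_assoc, ← fourier_add, show -n + m = -(n - m) by ring]

theorem fourierCoeff_comp_add (F : AddCircle T → ℂ) (s : AddCircle T) (n : ℤ) :
    fourierCoeff (fun t => F (t + s)) n = fourier n s * fourierCoeff F n := by
  unfold fourierCoeff
  rw [← MeasureTheory.integral_const_mul, ← MeasureTheory.integral_add_right_eq_self
    (fun t => fourier n s * fourier (-n) t • F t) s]
  refine MeasureTheory.integral_congr_ae (MeasureTheory.ae_of_all _ fun t => ?_)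
  have h1 : fourier (-n) (t + s) = fourier (-n) t * fourier (-n) s := by
    simp only [fourier_apply, smul_add, AddCircle.toCircle_add, Circle.coe_mul]
  have h2 : fourier n s * fourier (-n) s = (1 : ℂ) := by
    rw [← fourier_add, add_neg_cancel, fourier_zero]
  simp only [smul_eq_mul]
  rw [h1]
  linear_combination (-(fourier (-n) t * F (t + s))) * h2

/-- By Parseval the coefficients are square summable; this is all the decay the Wronskian argument
needs. -/
theorem tendsto_fourierCoeff_cofinite (F : C(AddCircle T, ℂ)) :
    Tendsto (fourierCoeff F) cofinite (nhds 0) := by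
  have h := (hasSum_sq_fourierCoeff
    (ContinuousMap.toLp (E := ℂ) 2 AddCircle.haarAddCircle ℂ F)).summable.tendsto_cofinite_zero
  simp_rw [fourierCoeff_toLp] at h
  rw [tendsto_zero_iff_norm_tendsto_zero]
  have h2 := (Real.continuous_sqrt.tendsto 0).comp h
  simpa [Function.comp_def, Real.sqrt_sq] using h2

theorem eq_zero_of_fourierCoeff_eq_zero {F : C(AddCircle T, ℂ)} (h : ∀ n, fourierCoeff F n = 0)
    (t : AddCircle T) : F t = 0 := by
  have hs : Summable (fourierCoeff F) := by
    rw [show fourierCoeff F = fun _ => 0 from funext h]; exact summable_zero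
  have := has_pointwise_sum_fourier_series_of_summable hs t
  simp only [h, zero_smul] at this
  exact this.unique hasSum_zero

/-- The Fourier coefficients of a solution of the quasi-periodic equation solve the dual one. -/
theorem fourierCoeff_three_term {E lam p q : ℂ} (hlam : lam ≠ 0) (s : AddCircle T)
    {F : C(AddCircle T, ℂ)} (hF : ∀ t, E * F t - lam * (fourier 1 t * F t + fourier (-1) t * F t) =
      p * F (t + s) + q * F (t + -s)) (n : ℤ) :
    fourierCoeff F (n + 1) + fourierCoeff F (n - 1) =
      (E - p * fourier n s - q * fourier n (-s)) / lam * fourierCoeff F n := by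
  have hint : ∀ {g : AddCircle T → ℂ}, Continuous g →
      MeasureTheory.Integrable g AddCircle.haarAddCircle := fun hg =>
    hg.integrable_of_hasCompactSupport (HasCompactSupport.of_compactSpace _)
  have e : (fun t => E * F t) =
      ((fun t => lam * ((fun t => fourier 1 t * F t) + fun t => fourier (-1) t * F t) t) +
      ((fun t => p * (fun t => F (t + s)) t) + fun t => q * (fun t => F (t + -s)) t)) := by
    funext t
    simp only [Pi.add_apply]
    linear_combination hF t
  have h := congrFun (congrArg fourierCoeff e) n
  rw [fourierCoeff.add (hint (by simp only [Pi.add_def]; fun_prop)) (hint (by fun_prop)),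
    fourierCoeff.add (hint (by fun_prop)) (hint (by fun_prop))] at h
  simp only [Pi.add_apply] at h
  have hsum : fourierCoeff (fun t => (fourier 1 t : ℂ) * F t + fourier (-1) t * F t) n =
      fourierCoeff F (n - 1) + fourierCoeff F (n + 1) := by
    have := congrFun (fourierCoeff.add (f := fun t => fourier 1 t * F t)
      (g := fun t => fourier (-1) t * F t) (hint (by fun_prop)) (hint (by fun_prop))) n
    rwa [Pi.add_apply, fourierCoeff_fourier_mul, fourierCoeff_fourier_mul, sub_neg_eq_add] at this
  rw [fourierCoeff.const_mul, fourierCoeff.const_mul, fourierCoeff.const_mul,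
    fourierCoeff.const_mul, hsum, fourierCoeff_comp_add, fourierCoeff_comp_add] at h
  field_simp
  linear_combination -h

end Fourier

/-- A cocycle of almost Mathieu type is not continuously conjugate to a scalar matrix. -/
theorem IsConjugacy.false_of_scalar {lam α E σ : ℝ} {B : ℝ → Matrix (Fin 2) (Fin 2) ℝ}
    (hlam : lam ≠ 0) (hσ : σ ^ 2 = 1) (h : IsConjugacy α (cocycle lam E) B !![σ, 0; 0, σ]) :
    False := by
  have : Fact ((0 : ℝ) < 1) := ⟨one_pos⟩
  -- The second row is a shifted copy of the first, so each entry of the first row solves a scalar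
  -- second-order equation.
  have hB1 : ∀ x j, B (x + α) 1 j = σ * B x 0 j := by
    intro x j
    have := (h.cocycle_entries x j).2
    fin_cases j <;> simp at this ⊢ <;> rw [this] <;> linear_combination (-B (x + α) 1 _) * hσ
  have heq : ∀ x j, (E - 2 * lam * Real.cos (2 * Real.pi * x)) * B x 0 j =
      σ * (B (x + α) 0 j + B (x - α) 0 j) := by
    intro x j
    have h1 := (h.cocycle_entries x j).1
    have h2 := hB1 (x - α) j
    rw [sub_add_cancel] at h2
    rw [h2] at h1
    fin_cases j <;> simp at h1 ⊢ <;> linear_combination h1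
  -- A twist by `e^{πix}` makes the antiperiodic case periodic; it only changes the coefficients of
  -- the two translates by `e^{∓ωα}`.
  obtain ⟨ω, hω⟩ : ∃ ω : ℂ, (∀ x j, ((B (x + 1) 0 j : ℝ) : ℂ) * Complex.exp (ω * (x + 1 : ℝ)) =
      B x 0 j * Complex.exp (ω * x)) := by
    rcases h.sign with hs | hs
    · exact ⟨0, fun x j => by simp [hs]⟩
    · refine ⟨Real.pi * Complex.I, fun x j => ?_⟩
      rw [hs, show (Real.pi * Complex.I * (x + 1 : ℝ) : ℂ) =
        Real.pi * Complex.I * x + Real.pi * Complex.I by push_cast; ring, Complex.exp_add,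
        Complex.exp_pi_mul_I]
      push_cast; ring
  let f : Fin 2 → ℝ → ℂ := fun j x => B x 0 j * Complex.exp (ω * x)
  have hper : ∀ j, Function.Periodic (f j) 1 := fun j x => hω x j
  have hcont : ∀ j, Continuous (f j) := fun j => by
    have := h.continuous 0 j
    fun_prop
  let F : Fin 2 → C(AddCircle (1 : ℝ), ℂ) := fun j =>
    ⟨(hper j).lift, continuous_coinduced_dom.mpr (hcont j)⟩
  have hFc : ∀ j (x : ℝ), F j (x : AddCircle (1 : ℝ)) = B x 0 j * Complex.exp (ω * x) :=
    fun j x => rfl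
  have hF : ∀ j t, (E : ℂ) * F j t - lam * (fourier 1 t * F j t + fourier (-1) t * F j t) =
      σ * Complex.exp (-(ω * α)) * F j (t + (α : AddCircle (1 : ℝ))) +
        σ * Complex.exp (ω * α) * F j (t + -(α : AddCircle (1 : ℝ))) := by
    intro j t
    induction t using QuotientAddGroup.induction_on with
    | H x =>
      rw [← AddCircle.coe_neg, ← AddCircle.coe_add, ← AddCircle.coe_add, hFc, hFc, hFc,
        fourier_coe_apply, fourier_coe_apply]
      have h1 := congrArg (fun r : ℝ => (r : ℂ)) (heq x j)
      push_cast at h1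
      rw [Complex.cos] at h1
      have e1 : Complex.exp (ω * (x + α : ℝ)) = Complex.exp (ω * x) * Complex.exp (ω * α) := by
        rw [← Complex.exp_add]; push_cast; ring_nf
      have e2 : Complex.exp (ω * (x + -α : ℝ)) =
          Complex.exp (ω * x) * Complex.exp (-(ω * α)) := by
        rw [← Complex.exp_add]; push_cast; ring_nf
      have e3 : Complex.exp (-(ω * α)) * Complex.exp (ω * α) = 1 := by
        rw [← Complex.exp_add]; simp
      have e4 : Complex.exp (2 * Real.pi * Complex.I * (1 : ℤ) * x / (1 : ℝ)) =
          Complex.exp (2 * Real.pi * x * Complex.I) := by congr 1; push_cast; ring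
      have e5 : Complex.exp (2 * Real.pi * Complex.I * (-1 : ℤ) * x / (1 : ℝ)) =
          Complex.exp (-(2 * Real.pi * x) * Complex.I) := by congr 1; push_cast; ring
      rw [e1, e2, e4, e5, ← sub_eq_add_neg]
      linear_combination Complex.exp (ω * x) * h1 -
        σ * (B (x + α) 0 j + B (x - α) 0 j) * Complex.exp (ω * x) * e3
  have hlam' : (lam : ℂ) ≠ 0 := Complex.ofReal_ne_zero.mpr hlam
  obtain ⟨s, t, hst, hrel⟩ := exists_linear_relation_of_three_term
    (fourierCoeff_three_term hlam' _ (hF 0)) (fourierCoeff_three_term hlam' _ (hF 1))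
    (tendsto_fourierCoeff_cofinite _) (tendsto_fourierCoeff_cofinite _)
  have hint : ∀ g : C(AddCircle (1 : ℝ), ℂ),
      MeasureTheory.Integrable g AddCircle.haarAddCircle := fun g =>
    g.continuous.integrable_of_hasCompactSupport (HasCompactSupport.of_compactSpace _)
  have hzero := eq_zero_of_fourierCoeff_eq_zero (F := s • F 0 + t • F 1) fun n => by
    rw [ContinuousMap.coe_add, fourierCoeff.add (hint _) (hint _), Pi.add_apply,
      ContinuousMap.coe_smul, ContinuousMap.coe_smul, fourierCoeff.const_smul,
      fourierCoeff.const_smul]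
    exact hrel n
  have row0 : ∀ x : ℝ, s * B x 0 0 + t * B x 0 1 = 0 := by
    intro x
    have := hzero (x : AddCircle (1 : ℝ))
    simp only [ContinuousMap.add_apply, ContinuousMap.smul_apply, hFc, smul_eq_mul] at this
    have h2 : (s * B x 0 0 + t * B x 0 1) * Complex.exp (ω * x) = 0 := by linear_combination this
    exact (mul_eq_zero.mp h2).resolve_right (Complex.exp_ne_zero _)
  -- The relation between columns passes to the second row through the shift, so the determinant at
  -- `α` would be zero.
  have row1 : s * B (0 + α) 1 0 + t * B (0 + α) 1 1 = 0 := by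
    rw [hB1, hB1]; push_cast; linear_combination σ * row0 0
  have row0' := row0 (0 + α)
  have hd := congrArg (fun r : ℝ => (r : ℂ)) (h.det (0 + α))
  push_cast at hd
  rcases hst with hs | ht
  · exact hs (by linear_combination (-s) * hd + B (0 + α) 1 1 * row0' - B (0 + α) 0 1 * row1)
  · exact ht (by linear_combination (-t) * hd - B (0 + α) 1 0 * row0' + B (0 + α) 0 0 * row1)

/-! ### The rotation number of a cocycle conjugate to a constant rotation -/

theorem exists_int_forall_eq {X : Type*} [TopologicalSpace X] [PreconnectedSpace X] {f : X → ℝ}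
    (hf : Continuous f) (h : ∀ x, ∃ n : ℤ, f x = n) : ∃ n : ℤ, ∀ x, f x = n := by
  choose n hn using h
  have hc : Continuous n := by
    rw [Int.isClosedEmbedding_coe_real.isInducing.continuous_iff]
    exact hf.congr hn
  rcases isEmpty_or_nonempty X with _ | ⟨⟨x₀⟩⟩
  · exact ⟨0, fun x => isEmptyElim x⟩
  · exact ⟨n x₀, fun x => by rw [hn, PreconnectedSpace.constant ‹_› hc]⟩

theorem exists_continuous_log {z : ℝ → ℂ} (hz : Continuous z) (h0 : ∀ x, z x ≠ 0) :
    ∃ L : ℝ → ℂ, Continuous L ∧ ∀ x, Complex.exp (L x) = z x := by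
  obtain ⟨L, ⟨-, hL⟩, -⟩ := Complex.isCoveringMapOn_exp.existsUnique_continuousMap_lifts ⟨z, hz⟩
    (a₀ := 0) (e₀ := Complex.log (z 0)) (Complex.exp_log (h0 0)) h0
  exact ⟨L, L.continuous, fun x => congrFun hL x⟩

/-- The matrix of the rotation by the angle `τ`. -/
def rotation (τ : ℝ) : Matrix (Fin 2) (Fin 2) ℝ :=
  !![Real.cos τ, -Real.sin τ; Real.sin τ, Real.cos τ]

/-- The unit vector representing the class of `t` in `ℝ/(1/2)ℤ`. -/
def direction (t : ℝ) : Fin 2 → ℝ := ![Real.cos (2 * Real.pi * t), Real.sin (2 * Real.pi * t)]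

theorem rotation_mulVec_direction (φ t : ℝ) :
    (rotation (2 * Real.pi * φ)).mulVec (direction t) = direction (t + φ) := by
  ext i
  fin_cases i <;> simp [rotation, direction, Matrix.mulVec, dotProduct, Fin.sum_univ_two, mul_add,
    Real.cos_add, Real.sin_add] <;> ring

/-- Parallel directions have angles with vanishing sine of the difference. Only `r ≠ 0` is assumed,
because the scalar in `IsProjectiveLift.lifts` comes without a nonvanishing condition. -/
theorem exists_int_of_smul_direction_eq {r s a b : ℝ} (hr : r ≠ 0)
    (h : r • direction a = s • direction b) : ∃ n : ℤ, 2 * (a - b) = n := by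
  have h0 := congrFun h 0
  have h1 := congrFun h 1
  simp only [direction, Pi.smul_apply, smul_eq_mul, Matrix.cons_val_zero,
    Matrix.cons_val_one] at h0 h1
  have hs : Real.sin (2 * Real.pi * a - 2 * Real.pi * b) = 0 := by
    rw [Real.sin_sub]
    refine (mul_eq_zero.mp (?_ : r * _ = 0)).resolve_left hr
    linear_combination Real.cos (2 * Real.pi * b) * h1 - Real.sin (2 * Real.pi * b) * h0
  obtain ⟨n, hn⟩ := Real.sin_eq_zero_iff.mp hs
  refine ⟨n, mul_right_cancel₀ Real.pi_ne_zero ?_⟩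
  rw [hn]; ring

/-- A continuous family of matrices of determinant one acts on angles by a lift `g`, at bounded
distance from `t ↦ b x + t`, where `b` is a lift of the direction of the first column. -/
theorem exists_angle_lift {B : ℝ → Matrix (Fin 2) (Fin 2) ℝ}
    (hc : ∀ i j, Continuous fun x => B x i j)
    (hd : ∀ x, B x 0 0 * B x 1 1 - B x 0 1 * B x 1 0 = 1) :
    ∃ (b : ℝ → ℝ) (g : ℝ × ℝ → ℝ), Continuous b ∧ Continuous g ∧
      (∀ p, |g p - b p.1 - p.2| ≤ 1 / 2) ∧
      (∀ x, ∃ r : ℝ, r ≠ 0 ∧ ![B x 0 0, B x 1 0] = r • direction (b x)) ∧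
      ∀ p, ∃ r : ℝ, r ≠ 0 ∧ (B p.1).mulVec (direction p.2) = r • direction (g p) := by
  set z : ℝ → ℂ := fun x => B x 0 0 + B x 1 0 * Complex.I with hz
  have hz0 : ∀ x, z x ≠ 0 := by
    intro x h
    have h1 : B x 0 0 = 0 := by simpa [hz] using congrArg Complex.re h
    have h2 : B x 1 0 = 0 := by simpa [hz] using congrArg Complex.im h
    have := hd x
    rw [h1, h2] at this
    simp at this
  have c00 := hc 0 0
  have c01 := hc 0 1
  have c10 := hc 1 0
  have c11 := hc 1 1
  obtain ⟨L, hLc, hL⟩ := exists_continuous_log (z := z) (by fun_prop) hz0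
  set G : ℝ × ℝ → ℂ := fun p => ((B p.1).mulVec (direction p.2) 0 : ℝ) +
    ((B p.1).mulVec (direction p.2) 1 : ℝ) * Complex.I with hG
  set R : ℝ × ℝ → ℂ := fun p => (starRingEnd ℂ) (z p.1) * G p *
    Complex.exp (-((2 * Real.pi * p.2 : ℝ) * Complex.I)) with hR
  have hGe : ∀ p, G p = (B p.1 0 0 * Real.cos (2 * Real.pi * p.2) +
      B p.1 0 1 * Real.sin (2 * Real.pi * p.2) : ℝ) + (B p.1 1 0 * Real.cos (2 * Real.pi * p.2) +
      B p.1 1 1 * Real.sin (2 * Real.pi * p.2) : ℝ) * Complex.I := fun p => by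
    simp [hG, Matrix.mulVec, dotProduct, Fin.sum_univ_two, direction]
  -- Multiplication by `conj z` turns `B x` into the upper triangular matrix with rows `(m, q)` and
  -- `(0, 1)`, as `det B = 1`. Its eigenvalues `m` and `1` are positive, so it never sends a vector
  -- to a negative multiple of itself. Hence `arg R` is continuous and measures the deviation from
  -- `b x + t` by at most half a turn.
  have hRslit : ∀ p, R p ∈ Complex.slitPlane := by
    rintro ⟨x, t⟩
    have e : Complex.exp (-((2 * Real.pi * t : ℝ) * Complex.I)) =
        (Real.cos (2 * Real.pi * t) : ℝ) - (Real.sin (2 * Real.pi * t) : ℝ) * Complex.I := by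
      rw [← neg_mul, Complex.exp_mul_I, Complex.cos_neg, Complex.sin_neg, Complex.ofReal_cos,
        Complex.ofReal_sin]
      ring
    have hx := hd x
    set C := Real.cos (2 * Real.pi * t)
    set S := Real.sin (2 * Real.pi * t)
    have hCS : S ^ 2 + C ^ 2 = 1 := Real.sin_sq_add_cos_sq _
    set m := B x 0 0 ^ 2 + B x 1 0 ^ 2 with hm
    set q := B x 0 0 * B x 0 1 + B x 1 0 * B x 1 1 with hq
    have hm0 : 0 < m := by
      have := Complex.normSq_pos.mpr (hz0 x)
      rw [Complex.normSq_apply] at this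
      simp [hz] at this
      nlinarith
    have hre : (R (x, t)).re = m * C ^ 2 + q * C * S + S ^ 2 := by
      simp only [hR, hGe, e, hz]
      simp [-Complex.ofReal_cos, -Complex.ofReal_sin]
      linear_combination S ^ 2 * hx - C ^ 2 * hm - C * S * hq
    have him : (R (x, t)).im = (1 - m) * C * S - q * S ^ 2 := by
      simp only [hR, hGe, e, hz]
      simp [-Complex.ofReal_cos, -Complex.ofReal_sin]
      linear_combination C * S * hx + C * S * hm + S ^ 2 * hq
    rw [Complex.mem_slitPlane_iff, or_iff_not_imp_right, not_not]
    intro h0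
    rw [him] at h0
    rw [hre]
    by_cases hS : S = 0
    · have : C ^ 2 = 1 := by rw [hS] at hCS; linarith
      rw [hS]; nlinarith
    · have h1 : (1 - m) * C = q * S := by
        have : S * ((1 - m) * C - q * S) = 0 := by linear_combination h0
        linarith [(mul_eq_zero.mp this).resolve_left hS]
      have : m * C ^ 2 + q * C * S + S ^ 2 = 1 := by linear_combination (-C) * h1 + hCS
      rw [this]; exact one_pos
  have hRc : Continuous R := by
    have : G = fun p : ℝ × ℝ => (B p.1 0 0 * Real.cos (2 * Real.pi * p.2) +
      B p.1 0 1 * Real.sin (2 * Real.pi * p.2) : ℝ) + (B p.1 1 0 * Real.cos (2 * Real.pi * p.2) +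
      B p.1 1 1 * Real.sin (2 * Real.pi * p.2) : ℝ) * Complex.I := funext hGe
    rw [hR, this]
    have hzc : Continuous fun p : ℝ × ℝ => (starRingEnd ℂ) (z p.1) :=
      Complex.continuous_conj.comp (by fun_prop)
    have d00 := c00.comp (continuous_fst : Continuous (Prod.fst : ℝ × ℝ → ℝ))
    have d01 := c01.comp (continuous_fst : Continuous (Prod.fst : ℝ × ℝ → ℝ))
    have d10 := c10.comp (continuous_fst : Continuous (Prod.fst : ℝ × ℝ → ℝ))
    have d11 := c11.comp (continuous_fst : Continuous (Prod.fst : ℝ × ℝ → ℝ))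
    simp only [Function.comp_def] at d00 d01 d10 d11
    fun_prop
  have hR0 : ∀ p, R p ≠ 0 := fun p => Complex.slitPlane_ne_zero (hRslit p)
  have hpi : (0 : ℝ) < 2 * Real.pi := by positivity
  have hexp : ∀ w : ℂ, w ≠ 0 → w = ‖w‖ * Complex.exp (w.arg * Complex.I) := fun w _ =>
    (Complex.norm_mul_exp_arg_mul_I w).symm
  have todir : ∀ (u v r t : ℝ), (u + v * Complex.I : ℂ) =
      r * Complex.exp ((2 * Real.pi * t : ℝ) * Complex.I) → u = r * direction t 0 ∧
        v = r * direction t 1 := by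
    intro u v r t h
    rw [Complex.exp_mul_I, ← Complex.ofReal_cos, ← Complex.ofReal_sin] at h
    constructor
    · simpa [direction, -Complex.ofReal_cos, -Complex.ofReal_sin] using congrArg Complex.re h
    · simpa [direction, -Complex.ofReal_cos, -Complex.ofReal_sin] using congrArg Complex.im h
  have hzL : ∀ x, z x = Real.exp (L x).re *
      Complex.exp ((2 * Real.pi * ((L x).im / (2 * Real.pi)) : ℝ) * Complex.I) := by
    intro x
    rw [mul_div_cancel₀ _ hpi.ne', Complex.ofReal_exp, ← Complex.exp_add, Complex.re_add_im, hL]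
  refine ⟨fun x => (L x).im / (2 * Real.pi),
    fun p => (L p.1).im / (2 * Real.pi) + p.2 + (R p).arg / (2 * Real.pi), ?_, ?_, ?_, ?_, ?_⟩
  · exact (Complex.continuous_im.comp hLc).div_const _
  · have harg : Continuous fun p => (R p).arg := continuous_iff_continuousAt.mpr fun p =>
      (Complex.continuousAt_arg (hRslit p)).comp hRc.continuousAt
    have := (Complex.continuous_im.comp hLc).comp (continuous_fst : Continuous (Prod.fst : ℝ × ℝ → ℝ))
    exact ((this.div_const _).add continuous_snd).add (harg.div_const _)
  · intro p
    have := Complex.abs_arg_le_pi (R p)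
    rw [show (L p.1).im / (2 * Real.pi) + p.2 + (R p).arg / (2 * Real.pi) -
      (L p.1).im / (2 * Real.pi) - p.2 = (R p).arg / (2 * Real.pi) by ring, abs_div,
      abs_of_pos hpi, div_le_iff₀ hpi]
    linarith
  · intro x
    refine ⟨Real.exp (L x).re, (Real.exp_pos _).ne', ?_⟩
    obtain ⟨h1, h2⟩ := todir _ _ _ _ (hzL x)
    ext i
    fin_cases i
    · exact h1
    · exact h2
  · intro p
    have hnz : (Real.exp (L p.1).re) ≠ 0 := (Real.exp_pos _).ne'
    refine ⟨‖R p‖ / Real.exp (L p.1).re, div_ne_zero (norm_ne_zero_iff.mpr (hR0 p)) hnz, ?_⟩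
    have hkey : G p = (‖R p‖ / Real.exp (L p.1).re : ℝ) *
        Complex.exp ((2 * Real.pi * ((L p.1).im / (2 * Real.pi) + p.2 +
          (R p).arg / (2 * Real.pi)) : ℝ) * Complex.I) := by
      have e1 : (2 * Real.pi * ((L p.1).im / (2 * Real.pi) + p.2 +
          (R p).arg / (2 * Real.pi)) : ℝ) = 2 * Real.pi * ((L p.1).im / (2 * Real.pi)) +
            2 * Real.pi * p.2 + (R p).arg := by field_simp
      have hzp := hzL p.1
      rw [e1, Complex.ofReal_add, Complex.ofReal_add, add_mul, add_mul, Complex.exp_add,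
        Complex.exp_add]
      set U := Complex.exp ((2 * Real.pi * ((L p.1).im / (2 * Real.pi)) : ℝ) * Complex.I) with hU
      have hUU : (starRingEnd ℂ) U * U = 1 := by
        rw [hU, ← Complex.exp_conj, ← Complex.exp_add, map_mul, Complex.conj_ofReal, Complex.conj_I]
        simp
      have hV : Complex.exp (-((2 * Real.pi * p.2 : ℝ) * Complex.I)) *
          Complex.exp ((2 * Real.pi * p.2 : ℝ) * Complex.I) = 1 := by
        rw [← Complex.exp_add]; simp
      have hRp := hexp (R p) (hR0 p)
      have hRdef : R p = (starRingEnd ℂ) (z p.1) * G p *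
        Complex.exp (-((2 * Real.pi * p.2 : ℝ) * Complex.I)) := rfl
      rw [hzp, map_mul, Complex.conj_ofReal] at hRdef
      have hnz' : ((Real.exp (L p.1).re : ℝ) : ℂ) ≠ 0 := Complex.ofReal_ne_zero.mpr hnz
      rw [Complex.ofReal_div, div_mul_eq_mul_div, eq_div_iff hnz']
      linear_combination (-(Real.exp (L p.1).re : ℂ) * G p) * hUU -
        (Real.exp (L p.1).re : ℂ) * G p * ((starRingEnd ℂ) U * U) * hV +
        U * Complex.exp ((2 * Real.pi * p.2 : ℝ) * Complex.I) * (hRp - hRdef)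
    obtain ⟨h1, h2⟩ := todir _ _ _ _ hkey
    ext i
    fin_cases i
    · exact h1
    · exact h2

theorem IsProjectiveLift.add_int_div_two {A : ℝ → Matrix.SpecialLinearGroup (Fin 2) ℝ}
    {F : ℝ × ℝ → ℝ} (hF : IsProjectiveLift A F) (θ φ : ℝ) (m : ℤ) :
    F (θ, φ + m / 2) = F (θ, φ) + m / 2 := by
  induction m using Int.induction_on with
  | zero => simp
  | succ i ih =>
    have := hF.periodic_fibre θ (φ + i / 2)
    push_cast at ih ⊢
    rw [add_div, ← add_assoc, this, ih]; ring
  | pred i ih =>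
    have := hF.periodic_fibre θ (φ + ((-i - 1 : ℤ) : ℝ) / 2)
    push_cast at ih this ⊢
    rw [show φ + (-(i : ℝ) - 1) / 2 + 1 / 2 = φ + -(i : ℝ) / 2 by ring, ih] at this
    linarith

/-- The angle lift `g` of `B` semiconjugates the translation `(x, t) ↦ (x + α, t + φ)` to the lifted
cocycle, up to a constant `m / 2`. The turning of the first column adds `d / 2` per period of `x`,
and every other contribution stays bounded, so the limit is `φ + dα/2 + m/2`. -/
theorem IsConjugacy.exists_rotationNumber_eq {α ρ φ : ℝ}
    {A : ℝ → Matrix.SpecialLinearGroup (Fin 2) ℝ} {B : ℝ → Matrix (Fin 2) (Fin 2) ℝ}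
    (h : IsConjugacy α A B (rotation (2 * Real.pi * φ))) (hρ : IsRotationNumber α A ρ) :
    ∃ k l : ℤ, 2 * ρ = 2 * φ + k * α + l := by
  obtain ⟨F, hF, hlim⟩ := hρ
  obtain ⟨b, g, hb, hg, hgb, hbB, hgB⟩ := exists_angle_lift h.continuous h.det
  obtain ⟨d, hd⟩ : ∃ d : ℤ, ∀ x, 2 * (b (x + 1) - b x) = d := by
    refine exists_int_forall_eq (by fun_prop) fun x => ?_
    obtain ⟨r, hr, h1⟩ := hbB x
    obtain ⟨r', hr', h2⟩ := hbB (x + 1)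
    rcases h.sign with hs | hs
    · exact exists_int_of_smul_direction_eq hr' (s := r) (by rw [← h1, ← h2, hs, hs])
    · refine exists_int_of_smul_direction_eq hr' (s := -r) ?_
      rw [neg_smul, ← h1, ← h2, hs, hs]
      ext i; fin_cases i <;> rfl
  obtain ⟨m, hm⟩ : ∃ m : ℤ, ∀ p : ℝ × ℝ,
      2 * (F (p.1, g p) - g (p.1 + α, p.2 + φ)) = m := by
    have := hF.continuous
    refine exists_int_forall_eq (by fun_prop) fun ⟨x, t⟩ => ?_
    obtain ⟨r, hr, h1⟩ := hgB (x, t)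
    obtain ⟨r', hr', h2⟩ := hgB (x + α, t + φ)
    obtain ⟨s, hs⟩ := hF.lifts x (g (x, t))
    change _ = s • direction (F (x, g (x, t))) at hs
    change (A x).1.mulVec (direction (g (x, t))) = _ at hs
    have h3 : (r * s) • direction (F (x, g (x, t))) = r' • direction (g (x + α, t + φ)) := by
      rw [mul_smul, ← hs, ← h2, ← Matrix.mulVec_smul, ← h1, Matrix.mulVec_mulVec, h.conj,
        ← Matrix.mulVec_mulVec, rotation_mulVec_direction]
    obtain ⟨n, hn⟩ := exists_int_of_smul_direction_eq hr' h3.symm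
    exact ⟨-n, by push_cast; linarith⟩
  -- Starting at a point in the image of `g` keeps the whole orbit there, up to half-integers.
  have hiter : ∀ n : ℕ, (fun p : ℝ × ℝ => (p.1 + α, F p))^[n] (0, g (0, 0)) =
      (n * α, g (n * α, n * φ) + (n * m : ℤ) / 2) := by
    intro n
    induction n with
    | zero => simp
    | succ n ih =>
      rw [Function.iterate_succ_apply', ih, Prod.mk.injEq]
      dsimp only
      rw [hF.add_int_div_two]
      have := hm (n * α, n * φ)
      dsimp only at this
      push_cast
      rw [add_mul (n : ℝ) 1 α, add_mul (n : ℝ) 1 φ, one_mul, one_mul]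
      exact ⟨rfl, by linarith⟩
  have hbper : Function.Periodic (fun x => b x - d / 2 * x) 1 := fun x => by
    have := hd x
    dsimp only
    linarith
  obtain ⟨K, hK⟩ := (hbper.compact_of_continuous one_ne_zero (by fun_prop)).isBounded.exists_norm_le
  have hK' : ∀ x, |b x - d / 2 * x| ≤ K := fun x => hK _ ⟨x, rfl⟩
  have hlim0 := hlim 0 (g (0, 0))
  have htend : Tendsto (fun n : ℕ =>
      (((fun p : ℝ × ℝ => (p.1 + α, F p))^[n] (0, g (0, 0))).2 - g (0, 0)) / (n : ℝ)) atTop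
      (nhds (φ + d / 2 * α + m / 2)) := by
    rw [← tendsto_sub_nhds_zero_iff]
    refine squeeze_zero_norm' (a := fun n : ℕ => (K + 1 / 2 + |g (0, 0)|) / n) ?_
      (tendsto_const_div_atTop_nhds_zero_nat _)
    filter_upwards [eventually_gt_atTop 0] with n hn
    have hn' : (0 : ℝ) < n := by exact_mod_cast hn
    rw [hiter]
    dsimp only
    rw [Real.norm_eq_abs, show (g (n * α, n * φ) + (n * m : ℤ) / 2 - g (0, 0)) / n -
      (φ + d / 2 * α + m / 2) = (((b (n * α) - d / 2 * (n * α)) +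
        (g (n * α, n * φ) - b (n * α) - n * φ)) - g (0, 0)) / n by
          push_cast; field_simp; ring, abs_div, abs_of_pos hn']
    gcongr
    refine (abs_sub _ _).trans ?_
    gcongr
    exact (abs_add_le _ _).trans (add_le_add (hK' _) (hgb (n * α, n * φ)))
  rw [htend.limsup_eq] at hlim0
  exact ⟨d, m, by rw [← hlim0]; ring⟩

/-! ### Normal forms in `SL(2, ℝ)` -/

theorem exists_conj_triangular {C : Matrix (Fin 2) (Fin 2) ℝ} (hC : C.det = 1)
    (htr : 4 ≤ (C 0 0 + C 1 1) ^ 2) : ∃ (M : Matrix (Fin 2) (Fin 2) ℝ) (μ ν c : ℝ),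
      M.det = 1 ∧ μ * ν = 1 ∧ C * M = M * !![μ, c; 0, ν] := by
  rw [Matrix.det_fin_two] at hC
  by_cases h : C 1 0 = 0
  · refine ⟨1, C 0 0, C 1 1, C 0 1, Matrix.det_one, by rw [h] at hC; linarith, ?_⟩
    rw [mul_one, one_mul]
    ext i j
    fin_cases i <;> fin_cases j <;> simp [h]
  · set s := Real.sqrt ((C 0 0 + C 1 1) ^ 2 - 4) with hs
    have hs2 : s ^ 2 = (C 0 0 + C 1 1) ^ 2 - 4 := Real.sq_sqrt (by linarith)
    set μ := (C 0 0 + C 1 1 + s) / 2 with hμ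
    set ν := (C 0 0 + C 1 1 - s) / 2 with hν
    have hμν : μ * ν = 1 := by rw [hμ, hν]; linear_combination (-1 / 4) * hs2
    have hsum : μ + ν = C 0 0 + C 1 1 := by rw [hμ, hν]; ring
    -- The first column is an eigenvector for `μ`; the second is any vector completing it to
    -- determinant one.
    refine ⟨!![μ - C 1 1, -(1 / C 1 0); C 1 0, 0], μ, ν, -(1 / C 1 0), ?_, hμν, ?_⟩
    · rw [Matrix.det_fin_two]
      simp [h]
    · ext i j
      fin_cases i <;> fin_cases j <;> simp [Matrix.mul_apply, Fin.sum_univ_two]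
      · linear_combination (-hC) + hμν - μ * hsum
      · field_simp
        linarith
      · ring

theorem exists_conj_rotation {C : Matrix (Fin 2) (Fin 2) ℝ} (hC : C.det = 1)
    (htr : (C 0 0 + C 1 1) ^ 2 < 4) : ∃ (M : Matrix (Fin 2) (Fin 2) ℝ) (φ : ℝ),
      M.det = 1 ∧ C * M = M * rotation (2 * Real.pi * φ) := by
  rw [Matrix.det_fin_two] at hC
  have hc : C 1 0 ≠ 0 := fun h => by
    rw [h] at hC
    nlinarith [sq_nonneg (C 0 0 - C 1 1)]
  set t := (C 0 0 + C 1 1) / 2 with ht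
  -- The sign of `s` follows that of `C 1 0`, so that `k² C₁₀ = s` is solvable and the conjugating
  -- matrix has determinant one.
  obtain ⟨s, hs, hsc⟩ : ∃ s : ℝ, s ^ 2 = 1 - t ^ 2 ∧ 0 < s / C 1 0 := by
    have h1 : 0 < 1 - t ^ 2 := by rw [ht]; linarith
    rcases lt_or_gt_of_ne hc with h | h
    · exact ⟨-Real.sqrt (1 - t ^ 2), by rw [neg_sq, Real.sq_sqrt h1.le],
        div_pos_of_neg_of_neg (neg_neg_of_pos (Real.sqrt_pos.mpr h1)) h⟩
    · exact ⟨Real.sqrt (1 - t ^ 2), Real.sq_sqrt h1.le, div_pos (Real.sqrt_pos.mpr h1) h⟩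
  have hs0 : s ≠ 0 := fun h => by simp [h] at hsc
  obtain ⟨k, hk0, hk⟩ : ∃ k : ℝ, k ≠ 0 ∧ k ^ 2 * C 1 0 = s :=
    ⟨Real.sqrt (s / C 1 0), (Real.sqrt_pos.mpr hsc).ne', by
      rw [Real.sq_sqrt hsc.le, div_mul_cancel₀ _ hc]⟩
  have hw : ‖(t + s * Complex.I : ℂ)‖ = 1 := by
    rw [← sq_eq_sq₀ (norm_nonneg _) zero_le_one, Complex.sq_norm, Complex.normSq_add_mul_I, hs]
    ring
  set ψ := (t + s * Complex.I : ℂ).arg with hψ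
  have hcos : Real.cos ψ = t := by
    have := Complex.norm_mul_cos_arg (t + s * Complex.I : ℂ)
    rw [hw] at this
    simpa using this
  have hsin : Real.sin ψ = s := by
    have := Complex.norm_mul_sin_arg (t + s * Complex.I : ℂ)
    rw [hw] at this
    simpa using this
  -- `J = (C - t)/s` squares to `-1` by Cayley–Hamilton; the columns are `k e₁` and `J (k e₁)`.
  refine ⟨!![k, k * (C 0 0 - t) / s; 0, k * C 1 0 / s], ψ / (2 * Real.pi), ?_, ?_⟩
  · rw [Matrix.det_fin_two]
    simp
    field_simp
    exact hk
  · rw [mul_div_cancel₀ _ (by positivity), rotation, hcos, hsin]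
    have hd : C 1 1 = 2 * t - C 0 0 := by rw [ht]; ring
    rw [hd] at hC
    ext i j
    fin_cases i <;> fin_cases j <;> simp [Matrix.mul_apply, Fin.sum_univ_two, hd]
    · field_simp; ring
    · field_simp
      linear_combination hs - hC
    · field_simp
    · field_simp; ring

/-- In the frame rotating by `kπx`, the constant rotation becomes rotation by `lπ`, which is the
scalar `(-1)^l`. For odd `k` the new frame changes sign over a period, which is why conjugacies are
taken periodic only up to sign. -/
theorem IsConjugacy.exists_scalar_of_resonant {α φ : ℝ}
    {A : ℝ → Matrix.SpecialLinearGroup (Fin 2) ℝ} {B : ℝ → Matrix (Fin 2) (Fin 2) ℝ}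
    (h : IsConjugacy α A B (rotation (2 * Real.pi * φ))) {k l : ℤ} (hφ : 2 * φ = k * α + l) :
    ∃ (B' : ℝ → Matrix (Fin 2) (Fin 2) ℝ) (σ : ℝ), σ ^ 2 = 1 ∧
      IsConjugacy α A B' !![σ, 0; 0, σ] := by
  have hpar : ∀ n : ℤ, Real.sin (n * Real.pi) = 0 := Real.sin_int_mul_pi
  have hpar2 : ∀ n : ℤ, Real.cos (n * Real.pi) ^ 2 = 1 := fun n => by
    have := Real.sin_sq_add_cos_sq (n * Real.pi)
    rw [hpar] at this
    linarith
  refine ⟨fun x => B x * rotation (k * Real.pi * x), Real.cos (l * Real.pi), hpar2 l, ?_, ?_, ?_, ?_⟩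
  · intro i j
    have := h.continuous
    fin_cases j <;> simp [Matrix.mul_apply, Fin.sum_univ_two, rotation] <;> fun_prop
  · intro x
    simp [Matrix.mul_apply, Fin.sum_univ_two, rotation]
    linear_combination h.det x + (B x 0 0 * B x 1 1 - B x 0 1 * B x 1 0) *
      Real.sin_sq_add_cos_sq (k * Real.pi * x)
  · have hrot : ∀ x i j, rotation (k * Real.pi * (x + 1)) i j =
        Real.cos (k * Real.pi) * rotation (k * Real.pi * x) i j := by
      intro x i j
      rw [mul_add, mul_one]
      fin_cases i <;> fin_cases j <;> simp [rotation, Real.cos_add, Real.sin_add, hpar] <;> ring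
    have hmul : ∀ r s : ℝ, (∀ x i j, B (x + 1) i j = r * B x i j) → Real.cos (k * Real.pi) = s →
        ∀ x i j, (B (x + 1) * rotation (k * Real.pi * (x + 1))) i j =
          r * s * (B x * rotation (k * Real.pi * x)) i j := by
      intro r s hr hs x i j
      simp only [Matrix.mul_apply, Fin.sum_univ_two, hr, hrot, hs]
      ring
    rcases eq_or_eq_neg_of_sq_eq_sq _ _ ((hpar2 k).trans (one_pow 2).symm) with h1 | h1 <;> rcases h.sign with hs | hs
    · exact Or.inl fun x i j => by simpa using hmul 1 1 (by simpa using hs) h1 x i j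
    · exact Or.inr fun x i j => by simpa using hmul (-1) 1 (by simpa using hs) h1 x i j
    · exact Or.inr fun x i j => by simpa using hmul 1 (-1) (by simpa using hs) h1 x i j
    · exact Or.inl fun x i j => by simpa using hmul (-1) (-1) (by simpa using hs) h1 x i j
  · intro x
    have e : 2 * Real.pi * φ + k * Real.pi * x = k * Real.pi * (x + α) + l * Real.pi := by
      linear_combination Real.pi * hφ
    have e1 := congrArg Real.cos e
    have e2 := congrArg Real.sin e
    rw [Real.cos_add, Real.cos_add _ (l * Real.pi), hpar] at e1
    rw [Real.sin_add, Real.sin_add _ (l * Real.pi), hpar] at e2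
    have key : rotation (2 * Real.pi * φ) * rotation (k * Real.pi * x) =
        rotation (k * Real.pi * (x + α)) *
          !![Real.cos (l * Real.pi), 0; 0, Real.cos (l * Real.pi)] := by
      ext i j
      fin_cases i <;> fin_cases j <;>
        simp [rotation, Matrix.mul_apply, Fin.sum_univ_two] <;> linarith
    rw [← Matrix.mul_assoc, h.conj, Matrix.mul_assoc, key, Matrix.mul_assoc]

end AlmostMathieu

end

/-! ### Case analysis on the trace of the constant. -/

theorem theorem6p1 (lam α E₀ ρ η : ℝ) (hlam : lam ≠ 0) (hα : Irrational α)
    (hβ₀ : 0 ≤ AlmostMathieu.beta α) (hβ : AlmostMathieu.beta α < ⊤)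
    (hE₀ : E₀ ∈ AlmostMathieu.Sigma lam α)
    (hρ : AlmostMathieu.IsRotationNumber α (AlmostMathieu.cocycle lam E₀) ρ)
    (hres : ∃ k l : ℤ, 2 * ρ = k * α + l)
    (hη : 6 * AlmostMathieu.beta α < (η : EReal))
    (hred : AlmostMathieu.IsAnalyticallyReducible α (AlmostMathieu.cocycle lam E₀) η) :
    AlmostMathieu.IsGapEndpoint (AlmostMathieu.Sigma lam α) E₀ := by
  have hη0 : 0 < η := by
    have : (0 : EReal) ≤ 6 * AlmostMathieu.beta α := mul_nonneg (by norm_num) hβ₀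
    exact_mod_cast this.trans_lt hη
  obtain ⟨B, C, hC, h⟩ := hred.exists_isConjugacy hη0
  rcases lt_or_ge ((C 0 0 + C 1 1) ^ 2) 4 with htr | htr
  · obtain ⟨M, φ, hM, hCM⟩ := AlmostMathieu.exists_conj_rotation hC htr
    have h' := h.mul_right hM hCM
    obtain ⟨k, l, hkl⟩ := h'.exists_rotationNumber_eq hρ
    obtain ⟨k', l', hkl'⟩ := hres
    obtain ⟨B', σ, hσ, h''⟩ := h'.exists_scalar_of_resonant (k := k' - k) (l := l' - l)
      (by push_cast; linarith)
    exact (h''.false_of_scalar hlam hσ).elim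
  · obtain ⟨M, μ, ν, c, hM, hμν, hCM⟩ := AlmostMathieu.exists_conj_triangular hC htr
    have h' := h.mul_right hM hCM
    have habs : |μ| * |ν| = 1 := by rw [← abs_mul, hμν, abs_one]
    by_cases hμ : |μ| = 1
    · have hμ2 : μ ^ 2 = 1 := by rw [← sq_abs, hμ, one_pow]
      have hνμ : ν = μ := by linear_combination μ * hμν - ν * hμ2
      rw [hνμ] at h'
      -- The sign of `μ c` decides on which side of `E₀` the gap lies.
      rcases lt_trichotomy (μ * c) 0 with hc | hc | hc
      · obtain ⟨δ, hδ, hout⟩ := h'.exists_notMem_Sigma_of_parabolic hμ2 (τ := -1) (by norm_num)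
          (by linarith)
        refine AlmostMathieu.isGapEndpoint_of_right hE₀ hδ fun x hx => ?_
        have := hout (x - E₀) (by linarith [hx.1]) (by linarith [hx.2])
        rwa [show E₀ - -1 * (x - E₀) = x by ring] at this
      · have hc0 : c = 0 := by linear_combination μ * hc - c * hμ2
        rw [hc0] at h'
        exact (h'.false_of_scalar hlam hμ2).elim
      · obtain ⟨δ, hδ, hout⟩ := h'.exists_notMem_Sigma_of_parabolic hμ2 (τ := 1) (by norm_num)
          (by linarith)
        refine AlmostMathieu.isGapEndpoint_of_left hE₀ hδ fun x hx => ?_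
        have := hout (E₀ - x) (by linarith [hx.2]) (by linarith [hx.1])
        rwa [show E₀ - 1 * (E₀ - x) = x by ring] at this
    · refine (h'.notMem_Sigma_of_hyperbolic hμ (fun hν => hμ ?_) hE₀).elim
      rwa [hν, mul_one] at habs
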